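/- **Theorem (Energy equality).** Let $\Omega\subset\mathbb R^3$ be an open set (possibly unbounded; no regularity of $\partial\Omega$ is assumed), $0<T<\infty$, $Q_T=\Omega\times\,]0,T[$, $H=L^2(\Omega)^3$ with scalar product $(u,v)_H=\int_\Omega u\cdot v\,dx$. Let $$V=\Big\{u\in H:\ \exists F\in H\ \ \int_\Omega u\cdot\operatorname{curl}\varphi\,dx=\int_\Omega F\cdot\varphi\,dx\ \ \forall\varphi\in C_c^\infty(\Omega)^3\Big\},\qquad \operatorname{curl}u:=F,$$ with scalar product $(u,v)_V=\int_\Omega(u\cdot v+\operatorname{curl}u\cdot\operatorname{curl}v)\,dx$, and $$V_0=\Big\{u\in V:\ \int_\Omega \operatorname{curl}u\cdot\psi\,dx=\int_\Omega u\cdot\operatorname{curl}\psi\,dx\ \ \forall\psi\in V\Big\}.$$ Assume: - the entries of the $3\times3$ matrices $\varepsilon(x),\mu(x)$ are bounded measurable functions on $\Omega$; $\varepsilon(x)$ and $\mu(x)$ are symmetric for all $x\in\Omega$; and there are constants $\varepsilon_*,\mu_*>0$ with $\varepsilon(x)\xi\cdot\xi\ge\varepsilon_*|\xi|^2$ and $\mu(x)\xi\cdot\xi\ge\mu_*|\xi|^2$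 for all $x\in\Omega$, $\xi\in\mathbb R^3$; - $j(x,t,\xi)=j_0(x,t)+j_1(x,t,\xi)$, where $j_0\in L^2(Q_T)^3$; $(x,t)\mapsto j_1(x,t,\xi)$ is measurable on $Q_T$ for all $\xi\in\mathbb R^3$; $\xi\mapsto j_1(x,t,\xi)$ is continuous for a.e. $(x,t)\in Q_T$; and there is a constant $c_1>0$ with $|j_1(x,t,\xi)|\le c_1|\xi|$ for all $(x,t,\xi)\in Q_T\times\mathbb R^3$; - $e_0,h_0\in H$. Write $j(e)$ for $(x,t)\mapsto j(x,t,e(x,t))$. Let $(e,h)\in L^2(Q_T)^3\times L^2(Q_T)^3$ be a weak solution of $\partial_t(\varepsilon e)=\operatorname{curl}h-j(e)$, $\partial_t(\mu h)=-\operatorname{curl}e$ in $Q_T$, $n\times e=0$ on $\partial\Omega\times\,]0,T[$, $e=e_0$, $h=h_0$ at $t=0$, that is, $$-\int_{Q_T}\varepsilon e\cdot\partial_t\Phi\,dx\,dt+\int_{Q_T}\big(-h\cdot\operatorname{curl}\Phi+j(e)\cdot\Phi\big)\,dx\,dt=\int_\Omega\varepsilon e_0\cdot\Phi(\cdot,0)\,dx$$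 for all $\Phi\in L^2(0,T;V_0)$ with weak derivative $\partial_t\Phi\in L^2(Q_T)^3$ and $\Phi(\cdot,T)=0$, and $$-\int_{Q_T}\mu h\cdot\partial_t\Psi\,dx\,dt+\int_{Q_T}e\cdot\operatorname{curl}\Psi\,dx\,dt=\int_\Omega\mu h_0\cdot\Psi(\cdot,0)\,dx$$ for all $\Psi\in L^2(0,T;V)$ with weak derivative $\partial_t\Psi\in L^2(Q_T)^3$ and $\Psi(\cdot,T)=0$; here the values at $t=0$ and $t=T$ are those of the representatives of $\Phi,\Psi$ in $C([0,T];H)$. Then $e$ and $h$ have representatives $\hat e,\hat h\in C([0,T];H)$ (i.e. $\hat e(t)=e(\cdot,t)$ and $\hat h(t)=h(\cdot,t)$ in $H$ for a.e. $t$), the function $j(e)\cdot e$ is integrable over $Q_T$, and for these representatives $$\tfrac12\Big(\|\hat e(t)\|_{H_\varepsilon}^2+\|\hat h(t)\|_{H_\mu}^2\Big)+\int_0^t(j(e),e)_H\,ds=\tfrac12\Big(\|e_0\|_{H_\varepsilon}^2+\|h_0\|_{H_\mu}^2\Big)\quad\text{for all }t\in[0,T],$$ where $\|u\|_{H_\varepsilon}^2=\int_\Omega\varepsilon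 u\cdot u\,dx$ and $\|u\|_{H_\mu}^2=\int_\Omega\mu u\cdot u\,dx$. -/

import Mathlib

open MeasureTheory Set
open scoped ContDiff RealInnerProductSpace

/-- Euclidean three-space, for points as well as for vectors. -/
abbrev R3 : Type := EuclideanSpace ℝ (Fin 3)

/-- The space `L²(Ω)³` with its standard scalar product `∫_Ω u · v dx`. -/
abbrev L2 (Ω : Set R3) : Type := Lp R3 2 (volume.restrict Ω)

/-- The cylinder `Q_T = Ω × ]0,T[`. -/
def spaceTimeCylinder (Ω : Set R3) (T : ℝ) : Set (R3 × ℝ) := Ω ×ˢ Ioo 0 T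

/-- The product of a `3 × 3` matrix with a vector. -/
noncomputable def matVec (A : Matrix (Fin 3) (Fin 3) ℝ) (v : R3) : R3 :=
  WithLp.toLp 2 (A.mulVec (fun i => v i))

/-- The classical partial derivative `∂φ_k/∂x_i` at `x`. -/
noncomputable def partialD (φ : R3 → R3) (i k : Fin 3) (x : R3) : ℝ :=
  (fderiv ℝ φ x (EuclideanSpace.single i 1)) k

/-- The classical curl of a vector field. -/
noncomputable def classicalCurl (φ : R3 → R3) (x : R3) : R3 :=
  !₂[partialD φ 1 2 x - partialD φ 2 1 x,
     partialD φ 2 0 x - partialD φ 0 2 x,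
     partialD φ 0 1 x - partialD φ 1 0 x]

/-- `φ ∈ C_c^∞(Ω)³`, extended by zero to the whole space. -/
structure IsTestVectorField (Ω : Set R3) (φ : R3 → R3) : Prop where
  contDiff : ContDiff ℝ ∞ φ
  hasCompactSupport : HasCompactSupport φ
  tsupport_subset : tsupport φ ⊆ Ω

/-- The distribution `curl u` on `Ω` is represented by `F ∈ L²(Ω)³`. -/
def IsWeakCurl (Ω : Set R3) (u F : L2 Ω) : Prop :=
  ∀ φ : R3 → R3, IsTestVectorField Ω φ →
    (∫ x in Ω, ⟪u x, classicalCurl φ x⟫) = ∫ x in Ω, ⟪F x, φ x⟫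

theorem continuous_classicalCurl {φ : R3 → R3} (h : ContDiff ℝ ∞ φ) :
    Continuous (classicalCurl φ) := by
  have h1 : Continuous (fderiv ℝ φ) := h.continuous_fderiv (by simp)
  have h2 : ∀ i k, Continuous (partialD φ i k) := fun i k => by
    unfold partialD
    exact (EuclideanSpace.proj k : R3 →L[ℝ] ℝ).continuous.comp
      (h1.clm_apply continuous_const)
  unfold classicalCurl
  refine (PiLp.continuous_toLp 2 _).comp (continuous_pi fun i => ?_)
  fin_cases i
  · exact (h2 1 2).sub (h2 2 1)
  · exact (h2 2 0).sub (h2 0 2)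
  · exact (h2 0 1).sub (h2 1 0)

theorem hasCompactSupport_classicalCurl {φ : R3 → R3} (h : HasCompactSupport φ) :
    HasCompactSupport (classicalCurl φ) := by
  refine (h.fderiv ℝ).mono ?_
  intro x hx h0
  apply hx
  ext i
  fin_cases i <;> simp_all [classicalCurl, partialD]

theorem integrable_inner_of_continuous_of_hasCompactSupport {Ω : Set R3} (u : L2 Ω)
    {f : R3 → R3} (hf : Continuous f) (hc : HasCompactSupport f) :
    Integrable (fun x => ⟪u x, f x⟫) (volume.restrict Ω) := by
  have hm : MemLp f 2 (volume.restrict Ω) := hf.memLp_of_hasCompactSupport hc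
  refine (L2.integrable_inner (𝕜 := ℝ) u hm.toLp).congr ?_
  filter_upwards [hm.coeFn_toLp] with x hx
  rw [hx]

/-- The Hilbert space `V = H(curl;Ω)` of all `u ∈ L²(Ω)³` whose distributional curl is in
`L²(Ω)³`. An element is the pair `(u, curl u)`; the scalar product inherited from the
Hilbert sum `L²(Ω)³ ⊕ L²(Ω)³` is `∫_Ω (u · v + curl u · curl v) dx`. -/
def Hcurl (Ω : Set R3) : Submodule ℝ (WithLp 2 (L2 Ω × L2 Ω)) where
  carrier := {p | IsWeakCurl Ω p.fst p.snd}
  zero_mem' := by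
    intro φ _
    have h0 := Lp.coeFn_zero R3 2 (volume.restrict Ω)
    have h : ∀ f : R3 → R3, ∫ x in Ω, ⟪(0 : L2 Ω) x, f x⟫ = 0 := fun f => by
      rw [integral_congr_ae (g := fun _ => (0 : ℝ)) (by
        filter_upwards [h0] with x hx
        rw [hx]; simp)]
      simp
    exact (h _).trans (h _).symm
  add_mem' := by
    intro p q hp hq φ hφ
    have h : ∀ (u v : L2 Ω) (f : R3 → R3), Continuous f → HasCompactSupport f →
        ∫ x in Ω, ⟪(u + v : L2 Ω) x, f x⟫
          = (∫ x in Ω, ⟪u x, f x⟫) + ∫ x in Ω, ⟪v x, f x⟫ := fun u v f hf hc => by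
      rw [← integral_add
        (integrable_inner_of_continuous_of_hasCompactSupport u hf hc)
        (integrable_inner_of_continuous_of_hasCompactSupport v hf hc)]
      refine integral_congr_ae ?_
      filter_upwards [Lp.coeFn_add u v] with x hx
      rw [hx, Pi.add_apply, inner_add_left]
    have h1 := h p.fst q.fst _ (continuous_classicalCurl hφ.contDiff)
      (hasCompactSupport_classicalCurl hφ.hasCompactSupport)
    have h2 := h p.snd q.snd _ hφ.contDiff.continuous hφ.hasCompactSupport
    exact h1.trans ((congrArg₂ (· + ·) (hp φ hφ) (hq φ hφ)).trans h2.symm)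
  smul_mem' := by
    intro c p hp φ hφ
    have h : ∀ (u : L2 Ω) (f : R3 → R3),
        ∫ x in Ω, ⟪(c • u : L2 Ω) x, f x⟫ = c * ∫ x in Ω, ⟪u x, f x⟫ := fun u f => by
      rw [← integral_const_mul]
      refine integral_congr_ae ?_
      filter_upwards [Lp.coeFn_smul c u] with x hx
      rw [hx, Pi.smul_apply, real_inner_smul_left]
    exact (h p.fst _).trans ((congrArg (c * ·) (hp φ hφ)).trans (h p.snd _).symm)

/-- The field `u ∈ L²(Ω)³` underlying an element of `V`. -/
def fieldOf {Ω : Set R3} (u : Hcurl Ω) : L2 Ω := u.1.fst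

/-- The distributional curl of an element of `V`. -/
def curlOf {Ω : Set R3} (u : Hcurl Ω) : L2 Ω := u.1.snd

/-- The closed subspace `V₀` of all `u ∈ V` with
`∫_Ω curl u · ψ dx = ∫_Ω u · curl ψ dx` for all `ψ ∈ V`. -/
def Hcurl0 (Ω : Set R3) : Submodule ℝ (Hcurl Ω) where
  carrier := {u | ∀ ψ : Hcurl Ω, ⟪curlOf u, fieldOf ψ⟫ = ⟪fieldOf u, curlOf ψ⟫}
  zero_mem' := by
    intro ψ
    simp [curlOf, fieldOf]
  add_mem' := by
    intro u v hu hv ψ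
    have h1 : curlOf (u + v) = curlOf u + curlOf v := rfl
    have h2 : fieldOf (u + v) = fieldOf u + fieldOf v := rfl
    rw [h1, h2, inner_add_left, inner_add_left, hu ψ, hv ψ]
  smul_mem' := by
    intro c u hu ψ
    have h1 : curlOf (c • u) = c • curlOf u := rfl
    have h2 : fieldOf (c • u) = c • fieldOf u := rfl
    rw [h1, h2, real_inner_smul_left, real_inner_smul_left, hu ψ]

/-- Material matrices: measurable (in the sense of Lebesgue) and bounded entries, symmetric,
uniformly positive definite on `Ω`. -/
structure IsMaterialMatrix (Ω : Set R3) (A : R3 → Matrix (Fin 3) (Fin 3) ℝ) : Prop where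
  measurable : ∀ i k, AEStronglyMeasurable (fun x => A x i k) (volume.restrict Ω)
  bounded : ∃ M : ℝ, ∀ x ∈ Ω, ∀ i k, |A x i k| ≤ M
  symmetric : ∀ x ∈ Ω, (A x).IsSymm
  posDef : ∃ a : ℝ, 0 < a ∧ ∀ x ∈ Ω, ∀ ξ : R3, a * ‖ξ‖ ^ 2 ≤ ⟪matVec (A x) ξ, ξ⟫

/-- The hypotheses on the two parts of the current density `j(x,t,ξ) = j₀(x,t) + j₁(x,t,ξ)`:
`j₀` is square integrable, `j₁` is a Carathéodory function of linear growth. -/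
structure IsCurrentDensity (Ω : Set R3) (T : ℝ) (j₀ : R3 × ℝ → R3)
    (j₁ : R3 × ℝ → R3 → R3) : Prop where
  memLp : MemLp j₀ 2 (volume.restrict (spaceTimeCylinder Ω T))
  measurable : ∀ ξ : R3,
    AEStronglyMeasurable (fun z => j₁ z ξ) (volume.restrict (spaceTimeCylinder Ω T))
  continuous : ∀ᵐ z ∂(volume.restrict (spaceTimeCylinder Ω T)), Continuous (j₁ z)
  growth : ∃ c₁ : ℝ, 0 < c₁ ∧ ∀ z ∈ spaceTimeCylinder Ω T, ∀ ξ : R3, ‖j₁ z ξ‖ ≤ c₁ * ‖ξ‖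

/-- `w` is the derivative of `u` in the sense of distributions from `]0,T[` into `L²(Ω)³`. -/
def IsWeakTimeDeriv (Ω : Set R3) (T : ℝ) (u w : ℝ → L2 Ω) : Prop :=
  ∀ ζ : ℝ → ℝ, ContDiff ℝ ∞ ζ → HasCompactSupport ζ → tsupport ζ ⊆ Ioo 0 T →
    (∫ t in Ioo 0 T, deriv ζ t • u t) = -(∫ t in Ioo 0 T, ζ t • w t)

/-- `Φ ∈ L²(0,T;V)`, with weak time derivative `Φt ∈ L²(0,T;L²(Ω)³)`, and with vanishing final
value `Φ(·,T) = 0`. Values at single times are those of the continuous representative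
`Φc : [0,T] → L²(Ω)³` of `Φ`, which exists and is unique for such `Φ`. -/
structure IsSpaceTimeTest (Ω : Set R3) (T : ℝ) (Φ : ℝ → Hcurl Ω) (Φt Φc : ℝ → L2 Ω) :
    Prop where
  memLp : MemLp Φ 2 (volume.restrict (Ioo 0 T))
  memLp_deriv : MemLp Φt 2 (volume.restrict (Ioo 0 T))
  weakDeriv : IsWeakTimeDeriv Ω T (fun t => fieldOf (Φ t)) Φt
  continuousOn : ContinuousOn Φc (Icc 0 T)
  ae_eq : ∀ᵐ t ∂(volume.restrict (Ioo 0 T)), Φc t = fieldOf (Φ t)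
  final : Φc T = 0

/-- Weak solutions `(e,h) ∈ L²(Q_T)³ × L²(Q_T)³` of the initial-boundary value problem
`∂ₜ(ε e) = curl h - j(e)`, `∂ₜ(μ h) = -curl e` in `Q_T`, `n × e = 0` on `∂Ω × ]0,T[`,
`e = e₀`, `h = h₀` at `t = 0`. -/
structure IsWeakSolution (Ω : Set R3) (T : ℝ) (ε μ : R3 → Matrix (Fin 3) (Fin 3) ℝ)
    (j : R3 × ℝ → R3 → R3) (e₀ h₀ : L2 Ω) (e h : R3 × ℝ → R3) : Prop where
  memLp_e : MemLp e 2 (volume.restrict (spaceTimeCylinder Ω T))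
  memLp_h : MemLp h 2 (volume.restrict (spaceTimeCylinder Ω T))
  ampere : ∀ (Φ : ℝ → Hcurl Ω) (Φt Φc : ℝ → L2 Ω), IsSpaceTimeTest Ω T Φ Φt Φc →
    (∀ᵐ t ∂(volume.restrict (Ioo 0 T)), Φ t ∈ Hcurl0 Ω) →
    -(∫ t in Ioo 0 T, ∫ x in Ω, ⟪matVec (ε x) (e (x, t)), Φt t x⟫)
      + (∫ t in Ioo 0 T, ∫ x in Ω,
          (-⟪h (x, t), (curlOf (Φ t)) x⟫ + ⟪j (x, t) (e (x, t)), (fieldOf (Φ t)) x⟫))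
      = ∫ x in Ω, ⟪matVec (ε x) (e₀ x), Φc 0 x⟫
  faraday : ∀ (Ψ : ℝ → Hcurl Ω) (Ψt Ψc : ℝ → L2 Ω), IsSpaceTimeTest Ω T Ψ Ψt Ψc →
    -(∫ t in Ioo 0 T, ∫ x in Ω, ⟪matVec (μ x) (h (x, t)), Ψt t x⟫)
      + (∫ t in Ioo 0 T, ∫ x in Ω, ⟪e (x, t), (curlOf (Ψ t)) x⟫)
      = ∫ x in Ω, ⟪matVec (μ x) (h₀ x), Ψc 0 x⟫

/-- `uc ∈ C([0,T];L²(Ω)³)` is a representative of `u ∈ L²(Q_T)³`: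
`uc(t) = u(·,t)` for almost every `t`. -/
structure IsContinuousRep (Ω : Set R3) (T : ℝ) (u : R3 × ℝ → R3) (uc : ℝ → L2 Ω) :
    Prop where
  continuousOn : ContinuousOn uc (Icc 0 T)
  ae_eq : ∀ᵐ t ∂(volume.restrict (Ioo 0 T)),
    ∀ᵐ x ∂(volume.restrict Ω), uc t x = u (x, t)

/-- The square `∫_Ω A u · u dx` of the weighted norm of `u ∈ L²(Ω)³`. -/
noncomputable def weightedNormSq (Ω : Set R3) (A : R3 → Matrix (Fin 3) (Fin 3) ℝ)
    (u : L2 Ω) : ℝ :=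
  ∫ x in Ω, ⟪matVec (A x) (u x), u x⟫

/-!
The two weak equations are one abstract evolution equation `(M u)' = B u - f`, `u(0) = u₀` in the
Hilbert space `K = L²(Ω)³ ⊕ L²(Ω)³`, with `u = (e, h)`, `f = (j(e), 0)`, with the bounded symmetric
coercive operator `M = (ε, μ)`, and with the Maxwell operator `B (Φ, Ψ) = (curl Ψ, -curl Φ)` on
`V₀ × V`. By the definition of `V₀` and because `V₀` contains the test fields, `B` is skew-adjoint
(`isSkewAdjointGraph_maxwellGraph`); no regularity of the boundary enters. As `|j(e)| ≤ |j₀| + c₁ |e|`,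
the source `j(e)` is just some element of `L²(Q_T)³`, and the equation can be treated as a linear one.

For `l > 0` the operator `R = (M + l B)⁻¹` is bounded, uniformly in `l`, and `R M → 1`, `M R → 1`
strongly as `l → 0` (`IsSkewAdjointGraph.exists_regularization`). Testing the weak equation with
`ζ(t) (M - l B)⁻¹ z` shows that `v = R M u` is a primitive (`ae_eq_primitive_of_weak`) which satisfies
`M v' = B v - M R f` with values `v` in the domain of `B`. As `⟪B v, v⟫ = 0`, the product rule for
primitives (`integral_bilinear_primitive`) gives the energy equality for `v`, and for the difference
of two such functions with different `l`. The latter bounds the difference uniformly on `[0,T]`, so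
that the functions `v` converge uniformly, necessarily to a continuous representative of `u`, and
the energy equality passes to the limit (`IsSkewAdjointGraph.exists_continuous_energy_eq`).
-/

/-! ### Primitives of Bochner integrable functions -/

section Primitives
open Filter Topology intervalIntegral

theorem AbsolutelyContinuousOnInterval.of_dist_le {X Y : Type*} [PseudoMetricSpace X]
    [PseudoMetricSpace Y] {f : ℝ → X} {g : ℝ → Y} {a b C : ℝ}
    (hg : AbsolutelyContinuousOnInterval g a b)
    (h : ∀ s ∈ uIcc a b, ∀ t ∈ uIcc a b, dist (f s) (f t) ≤ C * dist (g s) (g t)) :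
    AbsolutelyContinuousOnInterval f a b := by
  refine squeeze_zero' (Eventually.of_forall fun _ => Finset.sum_nonneg fun i _ => dist_nonneg)
    ?_ (by simpa using Tendsto.const_mul C hg)
  rw [eventually_inf_principal]
  filter_upwards with E hE
  rw [Finset.mul_sum]
  exact Finset.sum_le_sum fun i hi => h _ (hE.1 i hi).1 _ (hE.1 i hi).2

variable {E F G : Type*} [NormedAddCommGroup E] [NormedSpace ℝ E] [CompleteSpace E]
  [NormedAddCommGroup F] [NormedSpace ℝ F] [CompleteSpace F]
  [NormedAddCommGroup G] [NormedSpace ℝ G] [CompleteSpace G]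

omit [CompleteSpace E] in
/-- If `‖f‖ ≤ p`, increments of a primitive of `f` are bounded by those of the primitive of `p`. This
reduces absolute continuity of Bochner integrals to the case of real functions. -/
theorem dist_primitive_le {f : ℝ → E} {p : ℝ → ℝ} {a b : ℝ} {F₀ : E}
    (hf : IntervalIntegrable f volume a b) (hp : IntervalIntegrable p volume a b)
    (hfp : ∀ x, ‖f x‖ ≤ p x) {s t : ℝ} (hs : s ∈ uIcc a b) (ht : t ∈ uIcc a b) :
    dist (F₀ + ∫ x in a..s, f x) (F₀ + ∫ x in a..t, f x)
      ≤ dist (∫ x in a..s, p x) (∫ x in a..t, p x) := by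
  have hsub : ∀ {u}, u ∈ uIcc a b → uIcc a u ⊆ uIcc a b := fun hu =>
    uIcc_subset_uIcc left_mem_uIcc hu
  rw [dist_add_left, dist_eq_norm, dist_eq_norm,
    integral_interval_sub_left (hf.mono_set (hsub hs)) (hf.mono_set (hsub ht)),
    integral_interval_sub_left (hp.mono_set (hsub hs)) (hp.mono_set (hsub ht)), Real.norm_eq_abs]
  exact norm_integral_le_abs_of_norm_le (ae_of_all _ fun x => hfp x)
    (hp.mono_set (uIcc_subset_uIcc ht hs))

/-- The fundamental theorem of calculus for absolutely continuous functions with values in a Banach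
space, where differentiability almost everywhere is an assumption. -/
theorem AbsolutelyContinuousOnInterval.integral_eq_sub_of_ae_hasDerivAt {f f' : ℝ → E} {a b : ℝ}
    (hf : AbsolutelyContinuousOnInterval f a b) (hf' : IntervalIntegrable f' volume a b)
    (h : ∀ᵐ x, x ∈ uIcc a b → HasDerivAt f (f' x) x) :
    ∫ x in a..b, f' x = f b - f a := by
  have hac : AbsolutelyContinuousOnInterval (fun x => ∫ y in a..x, f' y) a b := by
    refine AbsolutelyContinuousOnInterval.of_dist_le (C := 1)
      (hf'.norm.absolutelyContinuousOnInterval_intervalIntegral left_mem_uIcc)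
      fun s hs t ht => ?_
    simpa using dist_primitive_le (F₀ := 0) hf' hf'.norm (fun x => le_rfl) hs ht
  obtain ⟨C, hC⟩ := (hf.sub hac).const_of_ae_hasDerivAt_zero (by
    filter_upwards [h, hf'.ae_hasDerivAt_integral] with x h1 h2 hx
    simpa using (h1 hx).sub (h2 hx a left_mem_uIcc))
  have h1 := hC a left_mem_uIcc
  have h2 := hC b right_mem_uIcc
  simp only [Pi.sub_apply, integral_same, sub_zero] at h1 h2
  rw [h1, ← h2, sub_sub_cancel]

/-- The product rule, in integrated form, for a continuous bilinear expression in two primitives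
of Bochner integrable functions. -/
theorem integral_bilinear_primitive (B : E →L[ℝ] F →L[ℝ] G) {f : ℝ → E} {g : ℝ → F} {a b : ℝ}
    (hf : IntervalIntegrable f volume a b) (hg : IntervalIntegrable g volume a b)
    (F₀ : E) (G₀ : F) :
    ∫ x in a..b, (B (f x) (G₀ + ∫ y in a..x, g y) + B (F₀ + ∫ y in a..x, f y) (g x))
      = B (F₀ + ∫ y in a..b, f y) (G₀ + ∫ y in a..b, g y) - B F₀ G₀ := by
  set p : ℝ → ℝ := fun x => ‖f x‖ + ‖g x‖
  have hp : IntervalIntegrable p volume a b := hf.norm.add hg.norm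
  have hfp : ∀ x, ‖f x‖ ≤ p x := fun x => by simp [p]
  have hgp : ∀ x, ‖g x‖ ≤ p x := fun x => by simp [p]
  have hP := hp.absolutelyContinuousOnInterval_intervalIntegral left_mem_uIcc
  set U : ℝ → E := fun x => F₀ + ∫ y in a..x, f y with hU
  set V : ℝ → F := fun x => G₀ + ∫ y in a..x, g y with hV
  have dU : ∀ s ∈ uIcc a b, ∀ t ∈ uIcc a b, dist (U s) (U t)
      ≤ dist (∫ x in a..s, p x) (∫ x in a..t, p x) :=
    fun s hs t ht => dist_primitive_le hf hp hfp hs ht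
  have dV : ∀ s ∈ uIcc a b, ∀ t ∈ uIcc a b, dist (V s) (V t)
      ≤ dist (∫ x in a..s, p x) (∫ x in a..t, p x) :=
    fun s hs t ht => dist_primitive_le hg hp hgp hs ht
  have acU : AbsolutelyContinuousOnInterval U a b :=
    .of_dist_le (C := 1) hP (by simpa using dU)
  have acV : AbsolutelyContinuousOnInterval V a b :=
    .of_dist_le (C := 1) hP (by simpa using dV)
  obtain ⟨CU, hCU⟩ := acU.exists_bound
  obtain ⟨CV, hCV⟩ := acV.exists_bound
  have acB : AbsolutelyContinuousOnInterval (fun x => B (U x) (V x)) a b := by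
    refine .of_dist_le (C := ‖B‖ * CV + ‖B‖ * CU) hP fun s hs t ht => ?_
    set d := dist (∫ x in a..s, p x) (∫ x in a..t, p x)
    have e : B (U s) (V s) - B (U t) (V t) = B (U s - U t) (V s) + B (U t) (V s - V t) := by
      simp
    have h1 : ‖B (U s - U t) (V s)‖ ≤ ‖B‖ * d * CV := by
      refine (B.le_opNorm₂ _ _).trans ?_
      have := dU s hs t ht
      rw [dist_eq_norm] at this
      have := hCV s hs
      gcongr
    have h2 : ‖B (U t) (V s - V t)‖ ≤ ‖B‖ * CU * d := by
      refine (B.le_opNorm₂ _ _).trans ?_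
      have := dV s hs t ht
      rw [dist_eq_norm] at this
      have := hCU t ht
      have : 0 ≤ CU := (norm_nonneg _).trans this
      gcongr
    rw [dist_eq_norm, e]
    refine (norm_add_le _ _).trans ?_
    linarith
  have key := acB.integral_eq_sub_of_ae_hasDerivAt
    (f' := fun x => B (f x) (V x) + B (U x) (g x)) ?_ ?_
  · rw [key]; simp [hU, hV]
  · refine IntervalIntegrable.add ?_ ?_
    · refine (hf.norm.const_mul (‖B‖ * CV)).mono_fun' ?_ ?_
      · exact B.aestronglyMeasurable_comp₂ hf.aestronglyMeasurable_restrict_uIoc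
          (((acV.continuousOn).mono uIoc_subset_uIcc).aestronglyMeasurable measurableSet_uIoc)
      · refine (ae_restrict_mem measurableSet_uIoc).mono fun x hx => ?_
        refine (B.le_opNorm₂ _ _).trans ?_
        have := hCV x (uIoc_subset_uIcc hx)
        calc ‖B‖ * ‖f x‖ * ‖V x‖ ≤ ‖B‖ * ‖f x‖ * CV := by gcongr
          _ = _ := by ring
    · refine (hg.norm.const_mul (‖B‖ * CU)).mono_fun' ?_ ?_
      · exact B.aestronglyMeasurable_comp₂
          (((acU.continuousOn).mono uIoc_subset_uIcc).aestronglyMeasurable measurableSet_uIoc)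
          hg.aestronglyMeasurable_restrict_uIoc
      · refine (ae_restrict_mem measurableSet_uIoc).mono fun x hx => ?_
        refine (B.le_opNorm₂ _ _).trans ?_
        have := hCU x (uIoc_subset_uIcc hx)
        change ‖B‖ * ‖U x‖ * ‖g x‖ ≤ ‖B‖ * CU * ‖g x‖
        gcongr
  · filter_upwards [hf.ae_hasDerivAt_integral, hg.ae_hasDerivAt_integral] with x h1 h2 hx
    have := B.hasFDerivAt_of_bilinear ((h1 hx a left_mem_uIcc).const_add F₀).hasFDerivAt
      ((h2 hx a left_mem_uIcc).const_add G₀).hasFDerivAt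
    have := this.hasDerivAt
    simpa [hU, hV, add_comm] using this

/-- A function of `t ∈ ]0,T[` whose weak derivative is `-b` and whose weak initial value is `v₀`
is almost everywhere the primitive `v₀ - ∫₀ᵗ b`. -/
theorem ae_eq_primitive_of_weak {T : ℝ} (hT : 0 < T) {v b : ℝ → E} {v₀ : E}
    (hv : IntegrableOn v (Ioo 0 T)) (hb : IntegrableOn b (Ioo 0 T))
    (h : ∀ ζ : ℝ → ℝ, ContDiff ℝ ∞ ζ → ζ T = 0 →
      -(∫ t in Ioo 0 T, deriv ζ t • v t) + (∫ t in Ioo 0 T, ζ t • b t) = ζ 0 • v₀) :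
    ∀ᵐ t ∂(volume.restrict (Ioo 0 T)), v t = v₀ - ∫ s in (0 : ℝ)..t, b s := by
  have hbi : IntervalIntegrable b volume 0 T := by
    rwa [intervalIntegrable_iff_integrableOn_Ioo_of_le hT.le]
  set c : ℝ → E := fun t => v₀ + ∫ s in (0 : ℝ)..t, -b s with hc
  have hcc : ContinuousOn c (Icc 0 T) := by
    have := continuousOn_primitive_interval' hbi.neg left_mem_uIcc
    rw [uIcc_of_le hT.le] at this
    exact continuousOn_const.add this
  have hci : IntegrableOn c (Ioo 0 T) :=
    (hcc.integrableOn_Icc).mono_set Ioo_subset_Icc_self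
  have key : ∀ᵐ t, t ∈ Ioo 0 T → v t - c t = 0 := by
    refine isOpen_Ioo.ae_eq_zero_of_integral_contDiff_smul_eq_zero
      (hv.sub hci).locallyIntegrableOn fun η hη hηc hηs => ?_
    -- `ζ` is the primitive of the test function `η` that vanishes at `T`
    set ζ : ℝ → ℝ := fun t => ∫ s in T..t, η s with hζ
    have hd : ∀ t, HasDerivAt ζ (η t) t := fun t =>
      integral_hasDerivAt_right (hη.continuous.intervalIntegrable _ _)
        (hη.continuous.stronglyMeasurableAtFilter _ _) hη.continuous.continuousAt
    have hd' : deriv ζ = η := funext fun t => (hd t).deriv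
    have hζs : ContDiff ℝ ∞ ζ := by
      rw [contDiff_infty_iff_deriv, hd']
      exact ⟨fun t => (hd t).differentiableAt, hη⟩
    have hζT : ζ T = 0 := by simp [hζ]
    have h1 := h ζ hζs hζT
    rw [hd'] at h1
    have hprim : ∀ t, ζ 0 + ∫ s in (0 : ℝ)..t, η s = ζ t := fun t => by
      rw [hζ]
      exact integral_add_adjacent_intervals (hη.continuous.intervalIntegrable _ _)
        (hη.continuous.intervalIntegrable _ _)
    have h2 := integral_bilinear_primitive (ContinuousLinearMap.lsmul ℝ ℝ : ℝ →L[ℝ] E →L[ℝ] E)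
      (hη.continuous.intervalIntegrable 0 T) hbi.neg (ζ 0) v₀
    simp only [hprim, hζT, ContinuousLinearMap.lsmul_apply, zero_smul, zero_sub,
      Pi.neg_apply] at h2
    have ibd : ∀ {k : ℝ → ℝ} {w : ℝ → E}, Continuous k → IntegrableOn w (Ioo 0 T) →
        IntegrableOn (fun t => k t • w t) (Ioo 0 T) := fun {k w} hk hw =>
      (((integrableOn_Icc_iff_integrableOn_Ioo).2 hw).continuousOn_smul hk.continuousOn
        isCompact_Icc).mono_set Ioo_subset_Icc_self
    rw [integral_of_le hT.le, integral_Ioc_eq_integral_Ioo] at h2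
    change ∫ t in Ioo 0 T, (η t • c t + ζ t • -b t) = _ at h2
    have hn : IntegrableOn (fun t => ζ t • -b t) (Ioo 0 T) := ibd hζs.continuous hb.neg
    rw [MeasureTheory.integral_add (ibd hη.continuous hci) hn] at h2
    simp only [smul_neg, MeasureTheory.integral_neg] at h2
    have h3 : ∫ t, η t • (v t - c t) = ∫ t in Ioo 0 T, η t • (v t - c t) := by
      refine (setIntegral_eq_integral_of_forall_compl_eq_zero fun t ht => ?_).symm
      rw [image_eq_zero_of_notMem_tsupport fun h => ht (hηs h), zero_smul]
    rw [h3]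
    simp only [smul_sub]
    rw [integral_sub (ibd hη.continuous hv) (ibd hη.continuous hci)]
    have h4 : ∫ t in Ioo 0 T, η t • c t
        = -(ζ 0 • v₀) + ∫ t in Ioo 0 T, ζ t • b t := by
      rw [← h2]; abel
    rw [h4, ← h1]; abel
  rw [ae_restrict_iff' measurableSet_Ioo]
  filter_upwards [key] with t ht htT
  rw [sub_eq_zero.1 (ht htT), hc]
  simp [sub_eq_add_neg]

end Primitives

/-! ### Skew-adjoint operators and their resolvents -/

section Resolvent
open Filter Topology

variable {K : Type*} [NormedAddCommGroup K] [InnerProductSpace ℝ K] [CompleteSpace K]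

/-- The submodule `G` of `K × K` is the graph of a skew-adjoint operator `B` of `K`: the pairs in
`G` are exactly the pairs `p` that satisfy `⟪p.2, q.1⟫ = -⟪p.1, q.2⟫` for all pairs `q` in `G`
(that is, the adjoint of `B` is `-B`), and `G` is single-valued. -/
structure IsSkewAdjointGraph (G : Submodule ℝ (K × K)) : Prop where
  mem_iff : ∀ p, p ∈ G ↔ ∀ q ∈ G, ⟪p.2, q.1⟫ = -⟪p.1, q.2⟫
  eq_zero : ∀ y : K, (0, y) ∈ G → y = 0

namespace IsSkewAdjointGraph

variable {G : Submodule ℝ (K × K)}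

omit [CompleteSpace K] in
theorem inner_self_eq_zero (hG : IsSkewAdjointGraph G) {p : K × K} (hp : p ∈ G) :
    ⟪p.2, p.1⟫ = 0 := by
  have := (hG.mem_iff p).1 hp p hp
  rw [real_inner_comm p.2 p.1] at this
  linarith

omit [CompleteSpace K] in
theorem isClosed (hG : IsSkewAdjointGraph G) : IsClosed (G : Set (K × K)) := by
  have : (G : Set (K × K)) = ⋂ q ∈ G, {p : K × K | ⟪p.2, q.1⟫ = -⟪p.1, q.2⟫} := by
    ext p
    simpa using hG.mem_iff p
  rw [this]
  refine isClosed_biInter fun q _ => isClosed_eq ?_ ?_ <;> fun_prop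

theorem dense_domain (hG : IsSkewAdjointGraph G) :
    Dense {x : K | ∃ y, (x, y) ∈ G} := by
  have h : (G.map (LinearMap.fst ℝ K K)).topologicalClosure = ⊤ := by
    rw [Submodule.topologicalClosure_eq_top_iff, Submodule.eq_bot_iff]
    intro z hz
    refine hG.eq_zero z ((hG.mem_iff _).2 fun q hq => ?_)
    rw [inner_zero_left, neg_zero, real_inner_comm]
    exact (Submodule.mem_orthogonal _ z).1 hz q.1 ⟨q, hq, rfl⟩
  have := Submodule.dense_iff_topologicalClosure_eq_top.2 h
  refine this.mono ?_
  rintro _ ⟨q, hq, rfl⟩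
  exact ⟨q.2, hq⟩

/-- The equation `M x + l B x = f` has a unique solution, and the solution operator is bounded,
uniformly in `l`: the range of `M + l B` is closed because `⟪B x, x⟫ = 0` makes this operator
coercive, and dense because its adjoint `M - l B` is injective. -/
theorem exists_resolvent (hG : IsSkewAdjointGraph G) {M : K →L[ℝ] K} {m : ℝ} (hm : 0 < m)
    (hM : ∀ x y, ⟪M x, y⟫ = ⟪x, M y⟫) (hcoer : ∀ x, m * ‖x‖ ^ 2 ≤ ⟪M x, x⟫) {l : ℝ}
    (hl : l ≠ 0) :
    ∃ R : K →L[ℝ] K, (∀ f, (R f, l⁻¹ • (f - M (R f))) ∈ G) ∧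
      (∀ p ∈ G, R (M p.1 + l • p.2) = p.1) ∧ ∀ f, ‖R f‖ ≤ m⁻¹ * ‖f‖ := by
  have : CompleteSpace G := hG.isClosed.completeSpace_coe
  set S : G →L[ℝ] K := (M.comp (ContinuousLinearMap.fst ℝ K K)
    + l • ContinuousLinearMap.snd ℝ K K).comp G.subtypeL with hS
  have hSa : ∀ p : G, S p = M p.1.1 + l • p.1.2 := fun p => rfl
  have hb : ∀ p : G, ‖p.1.1‖ ≤ m⁻¹ * ‖S p‖ := fun p => by
    have h1 : m * ‖p.1.1‖ ^ 2 ≤ ‖S p‖ * ‖p.1.1‖ := by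
      calc m * ‖p.1.1‖ ^ 2 ≤ ⟪M p.1.1, p.1.1⟫ := hcoer _
        _ = ⟪S p, p.1.1⟫ := by
          rw [hSa, inner_add_left, real_inner_smul_left, hG.inner_self_eq_zero p.2]; simp
        _ ≤ _ := real_inner_le_norm _ _
    rw [← div_eq_inv_mul, le_div_iff₀ hm]
    rcases (norm_nonneg p.1.1).eq_or_lt with h0 | h0
    · rw [← h0]; simp
    · nlinarith
  have hb2 : ∀ p : G, ‖p.1.2‖ ≤ |l|⁻¹ * (1 + ‖M‖ * m⁻¹) * ‖S p‖ := fun p => by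
    have h2 : p.1.2 = l⁻¹ • (S p - M p.1.1) := by
      rw [hSa, add_sub_cancel_left, smul_smul, inv_mul_cancel₀ hl, one_smul]
    rw [h2, norm_smul, norm_inv, Real.norm_eq_abs, mul_assoc]
    gcongr
    refine (norm_sub_le _ _).trans ?_
    have := (M.le_opNorm p.1.1).trans (mul_le_mul_of_nonneg_left (hb p) (norm_nonneg M))
    linarith
  set C : ℝ := max m⁻¹ (|l|⁻¹ * (1 + ‖M‖ * m⁻¹)) with hC
  have hC0 : 0 ≤ C := (inv_nonneg.2 hm.le).trans (le_max_left _ _)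
  have hanti : AntilipschitzWith C.toNNReal S := by
    refine ContinuousLinearMap.antilipschitz_of_bound S fun p => ?_
    rw [Real.coe_toNNReal _ hC0]
    refine max_le ((hb p).trans ?_) ((hb2 p).trans ?_)
    · gcongr; exact le_max_left _ _
    · gcongr; exact le_max_right _ _
  have hker : S.ker = ⊥ := LinearMap.ker_eq_bot.2 hanti.injective
  have hcl : IsClosed (S.range : Set K) := by
    rw [LinearMap.coe_range]
    exact hanti.isClosed_range S.uniformContinuous
  have hrange : S.range = ⊤ := by
    rw [← hcl.submodule_topologicalClosure_eq, Submodule.topologicalClosure_eq_top_iff,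
      Submodule.eq_bot_iff]
    intro z hz
    have hz' : ∀ p ∈ G, ⟪M p.1 + l • p.2, z⟫ = 0 := fun p hp =>
      (Submodule.mem_orthogonal _ z).1 hz _ ⟨⟨p, hp⟩, rfl⟩
    -- `z` is in the domain of the adjoint of `B`, that is, of `B`, and `M z = l B z`
    have hzG : (z, l⁻¹ • M z) ∈ G := by
      refine (hG.mem_iff _).2 fun q hq => ?_
      have := hz' q hq
      rw [inner_add_left, real_inner_smul_left, hM, real_inner_comm, real_inner_comm z q.2] at this
      simp only [real_inner_smul_left]
      field_simp
      linarith
    have h0 := hG.inner_self_eq_zero hzG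
    simp only [real_inner_smul_left, mul_eq_zero, inv_eq_zero, hl, false_or] at h0
    have := hcoer z
    rw [h0] at this
    have : ‖z‖ ^ 2 = 0 := le_antisymm (by nlinarith) (by positivity)
    simpa using this
  set e := ContinuousLinearEquiv.ofBijective S hker hrange with he
  have heS : ∀ p : G, e p = S p := fun p => rfl
  refine ⟨((ContinuousLinearMap.fst ℝ K K).comp G.subtypeL).comp
    (e.symm : K →L[ℝ] G), fun f => ?_, fun p hp => ?_, fun f => ?_⟩
  · have h1 : S (e.symm f) = f := e.apply_symm_apply f
    have h2 : l⁻¹ • (f - M (e.symm f).1.1) = (e.symm f).1.2 := by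
      have h3 := hSa (e.symm f)
      rw [h1] at h3
      rw [sub_eq_of_eq_add' h3, smul_smul, inv_mul_cancel₀ hl, one_smul]
    change ((e.symm f).1.1, l⁻¹ • (f - M (e.symm f).1.1)) ∈ G
    rw [h2]
    exact (e.symm f).2
  · change (e.symm (S ⟨p, hp⟩)).1.1 = p.1
    rw [← heS, e.symm_apply_apply]
  · have h1 : S (e.symm f) = f := e.apply_symm_apply f
    have := hb (e.symm f)
    rwa [h1] at this

end IsSkewAdjointGraph

end Resolvent

/-! ### Regularization, energy of primitives -/

section Regularization
open Filter Topology

variable {K : Type*} [NormedAddCommGroup K] [InnerProductSpace ℝ K] [CompleteSpace K]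

omit [CompleteSpace K] in
/-- The zero operator is skew-adjoint. -/
theorem isSkewAdjointGraph_zero : IsSkewAdjointGraph (Submodule.prod (⊤ : Submodule ℝ K) ⊥) where
  mem_iff p := by
    constructor
    · rintro ⟨-, hp⟩ q ⟨-, hq⟩
      rw [SetLike.mem_coe, Submodule.mem_bot] at hp hq
      simp [hp, hq]
    · intro h
      have := h (p.2, 0) ⟨trivial, rfl⟩
      exact ⟨trivial, by simpa using this⟩
  eq_zero y hy := by simpa using hy.2

/-- The range of a coercive symmetric operator is the whole space. -/
theorem surjective_of_coercive {M : K →L[ℝ] K} {m : ℝ} (hm : 0 < m)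
    (hM : ∀ x y, ⟪M x, y⟫ = ⟪x, M y⟫) (hcoer : ∀ x, m * ‖x‖ ^ 2 ≤ ⟪M x, x⟫) :
    Function.Surjective M := by
  obtain ⟨R, hR, -, -⟩ := isSkewAdjointGraph_zero.exists_resolvent hm hM hcoer one_ne_zero
  refine fun f => ⟨R f, ?_⟩
  have := (hR f).2
  simp only [inv_one, one_smul, SetLike.mem_coe, Submodule.mem_bot] at this
  exact (sub_eq_zero.1 this).symm

/-- The regularizing operators `R n = (M + B / (n + 1))⁻¹`. Their adjoints `(M - B / (n + 1))⁻¹`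
take values in the domain of `B`. The products `R n M` and `M (R n)` converge strongly to the
identity. -/
theorem IsSkewAdjointGraph.exists_regularization {G : Submodule ℝ (K × K)}
    (hG : IsSkewAdjointGraph G) {M : K →L[ℝ] K} {m : ℝ} (hm : 0 < m)
    (hM : ∀ x y, ⟪M x, y⟫ = ⟪x, M y⟫) (hcoer : ∀ x, m * ‖x‖ ^ 2 ≤ ⟪M x, x⟫) :
    ∃ R : ℕ → K →L[ℝ] K,
      (∀ (n : ℕ) f, (R n f, ((n : ℝ) + 1) • (f - M (R n f))) ∈ G) ∧
      (∀ n f, ‖R n f‖ ≤ m⁻¹ * ‖f‖) ∧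
      (∀ (n : ℕ) z, ∃ p ∈ G, p.2 = ((n : ℝ) + 1) • (M p.1 - z) ∧ ∀ f, ⟪z, R n f⟫ = ⟪f, p.1⟫) ∧
      (∀ x, Tendsto (fun n => R n (M x)) atTop (𝓝 x)) ∧
      (∀ f, Tendsto (fun n => M (R n f)) atTop (𝓝 f)) := by
  have hl : ∀ n : ℕ, ((n : ℝ) + 1)⁻¹ ≠ 0 := fun n => by positivity
  choose R hR1 hR2 hR3 using fun n : ℕ => hG.exists_resolvent hm hM hcoer (hl n)
  have hRM : ∀ x, Tendsto (fun n => R n (M x)) atTop (𝓝 x) := by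
    intro x
    rw [Metric.tendsto_atTop]
    intro δ hδ
    set C := m⁻¹ * ‖M‖ + 1 with hC
    have hC0 : 0 < C := by positivity
    obtain ⟨x', ⟨y, hxy⟩, hx'⟩ := hG.dense_domain.exists_dist_lt x
      (show 0 < δ / (2 * C) by positivity)
    have hlim : Tendsto (fun n : ℕ => ((n : ℝ) + 1)⁻¹ * (m⁻¹ * ‖y‖)) atTop (𝓝 0) := by
      simpa using (tendsto_one_div_add_atTop_nhds_zero_nat (𝕜 := ℝ)).mul_const (m⁻¹ * ‖y‖)
    obtain ⟨n₀, hn₀⟩ := eventually_atTop.1 (hlim.eventually (gt_mem_nhds (half_pos hδ)))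
    refine ⟨n₀, fun n hn => ?_⟩
    have e1 : R n (M x') - x' = -(((n : ℝ) + 1)⁻¹ • R n y) := by
      have := hR2 n _ hxy
      simp only [map_add, map_smul] at this
      rw [sub_eq_iff_eq_add, ← sub_eq_neg_add]
      exact eq_sub_of_add_eq this
    have e2 : ‖R n (M x') - x'‖ < δ / 2 := by
      rw [e1, norm_neg, norm_smul, Real.norm_of_nonneg (by positivity)]
      refine lt_of_le_of_lt ?_ (hn₀ n hn)
      gcongr
      exact hR3 n y
    have e3 : ‖R n (M (x - x'))‖ ≤ m⁻¹ * ‖M‖ * ‖x - x'‖ := by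
      refine (hR3 n _).trans ?_
      rw [mul_assoc]
      gcongr
      exact M.le_opNorm _
    have e4 : C * ‖x - x'‖ < δ / 2 := by
      rw [dist_eq_norm, lt_div_iff₀ (by positivity)] at hx'
      linarith
    have e5 : R n (M x) - x = R n (M (x - x')) + (R n (M x') - x') - (x - x') := by
      simp only [map_sub]; abel
    rw [dist_eq_norm, e5]
    refine (norm_sub_le _ _).trans_lt ?_
    have := norm_add_le (R n (M (x - x'))) (R n (M x') - x')
    nlinarith
  refine ⟨R, fun n f => by simpa using hR1 n f, hR3, fun n z => ?_, hRM, fun f => ?_⟩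
  · -- `R'` is the resolvent `(M - B / (n + 1))⁻¹`
    obtain ⟨R', hR', -, -⟩ := hG.exists_resolvent hm hM hcoer (neg_ne_zero.2 (hl n))
    have e : (-((n : ℝ) + 1)⁻¹)⁻¹ • (z - M (R' z)) = ((n : ℝ) + 1) • (M (R' z) - z) := by
      rw [inv_neg, inv_inv, neg_smul, ← smul_neg, neg_sub]
    have h1 := hR' z
    rw [e] at h1
    refine ⟨_, h1, rfl, fun f => ?_⟩
    have h2 := (hG.mem_iff _).1 (hR1 n f) _ h1
    simp only [inv_inv, real_inner_smul_left, real_inner_smul_right, inner_sub_left,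
      inner_sub_right] at h2
    have h3 : ((n : ℝ) + 1) ≠ 0 := by positivity
    rw [← mul_neg] at h2
    have h4 := mul_left_cancel₀ h3 h2
    rw [hM] at h4
    rw [real_inner_comm]
    linarith
  · obtain ⟨x, rfl⟩ := surjective_of_coercive hm hM hcoer f
    exact (M.continuous.tendsto x).comp (hRM x)

/-- Energy identity for a primitive `c₀ + ∫ g` with respect to the quadratic form of `M`. -/
theorem energy_primitive {M : K →L[ℝ] K} (hM : ∀ x y, ⟪M x, y⟫ = ⟪x, M y⟫) {T : ℝ}
    {g : ℝ → K} (hg : IntegrableOn g (Ioo 0 T)) (c₀ : K) {θ : ℝ → ℝ}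
    (hθ : ∀ᵐ t ∂(volume.restrict (Ioo 0 T)), ⟪M (g t), c₀ + ∫ s in (0 : ℝ)..t, g s⟫ = θ t)
    {t : ℝ} (ht : t ∈ Icc 0 T) :
    ⟪M (c₀ + ∫ s in (0 : ℝ)..t, g s), c₀ + ∫ s in (0 : ℝ)..t, g s⟫
      = ⟪M c₀, c₀⟫ + 2 * ∫ s in (0 : ℝ)..t, θ s := by
  have hsub : Ioo 0 t ⊆ Ioo 0 T := Ioo_subset_Ioo_right ht.2
  have hgi : IntervalIntegrable g volume 0 t := by
    rw [intervalIntegrable_iff_integrableOn_Ioo_of_le ht.1]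
    exact hg.mono_set hsub
  have h := integral_bilinear_primitive ((innerSL ℝ).comp M : K →L[ℝ] K →L[ℝ] ℝ) hgi hgi c₀ c₀
  simp only [ContinuousLinearMap.comp_apply, innerSL_apply_apply] at h
  rw [← sub_eq_iff_eq_add', ← h, ← intervalIntegral.integral_const_mul,
    intervalIntegral.integral_of_le ht.1, intervalIntegral.integral_of_le ht.1,
    integral_Ioc_eq_integral_Ioo, integral_Ioc_eq_integral_Ioo]
  refine integral_congr_ae ?_
  filter_upwards [ae_mono (Measure.restrict_mono hsub le_rfl) hθ] with s hs
  rw [hM _ (g s), real_inner_comm (M (g s)), hs]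
  ring

theorem exists_continuousOn_tendsto {K : Type*} [NormedAddCommGroup K] [CompleteSpace K]
    {S : Set ℝ} {c : ℕ → ℝ → K} {δ : ℕ → ℝ}
    (hc : ∀ n, ContinuousOn (c n) S) (hδ : Tendsto δ atTop (𝓝 0))
    (h : ∀ n k, ∀ t ∈ S, ‖c n t - c k t‖ ^ 2 ≤ δ n + δ k) :
    ∃ v : ℝ → K, ContinuousOn v S ∧ ∀ t ∈ S, Tendsto (fun n => c n t) atTop (𝓝 (v t)) := by
  have hU : UniformCauchySeqOn c atTop S := by
    rw [Metric.uniformCauchySeqOn_iff]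
    intro r hr
    obtain ⟨N, hN⟩ := eventually_atTop.1
      (hδ.eventually (gt_mem_nhds (show 0 < r ^ 2 / 2 by positivity)))
    refine ⟨N, fun n hn k hk t ht => ?_⟩
    rw [dist_eq_norm]
    refine lt_of_pow_lt_pow_left₀ 2 hr.le ?_
    have := h n k t ht
    have := hN n hn
    have := hN k hk
    linarith
  have hex : ∀ t, ∃ y, t ∈ S → Tendsto (fun n => c n t) atTop (𝓝 y) := fun t => by
    by_cases ht : t ∈ S
    · obtain ⟨y, hy⟩ := cauchySeq_tendsto_of_complete (hU.cauchySeq ht)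
      exact ⟨y, fun _ => hy⟩
    · exact ⟨0, fun h => absurd h ht⟩
  choose v hv using hex
  exact ⟨v, (hU.tendstoUniformlyOn_of_tendsto fun t ht => hv t ht).continuousOn
    (Frequently.of_forall hc), fun t ht => hv t ht⟩

end Regularization

/-! ### The abstract evolution equation -/

section Evolution
open Filter Topology

variable {K : Type*} [NormedAddCommGroup K] [InnerProductSpace ℝ K] [CompleteSpace K]

/-- Energy equality for weak solutions of the abstract Cauchy problem `(M u)' = B u - f`,
`u(0) = u₀`, where `B` is the skew-adjoint operator with graph `G` and `M` is bounded, symmetric and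
coercive. -/
theorem IsSkewAdjointGraph.exists_continuous_energy_eq {G : Submodule ℝ (K × K)}
    (hG : IsSkewAdjointGraph G) {M : K →L[ℝ] K} {m : ℝ} (hm : 0 < m)
    (hM : ∀ x y, ⟪M x, y⟫ = ⟪x, M y⟫) (hcoer : ∀ x, m * ‖x‖ ^ 2 ≤ ⟪M x, x⟫)
    {T : ℝ} (hT : 0 < T) {u f : ℝ → K} (hu : MemLp u 2 (volume.restrict (Ioo 0 T)))
    (hf : MemLp f 2 (volume.restrict (Ioo 0 T))) (u₀ : K)
    (hweak : ∀ p ∈ G, ∀ ζ : ℝ → ℝ, ContDiff ℝ ∞ ζ → ζ T = 0 →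
      -(∫ t in Ioo 0 T, deriv ζ t * ⟪M (u t), p.1⟫)
        + (∫ t in Ioo 0 T, ζ t * (⟪u t, p.2⟫ + ⟪f t, p.1⟫)) = ζ 0 * ⟪M u₀, p.1⟫) :
    ∃ v : ℝ → K, ContinuousOn v (Icc 0 T) ∧
      (∀ᵐ t ∂(volume.restrict (Ioo 0 T)), v t = u t) ∧
      ∀ t ∈ Icc 0 T, 1 / 2 * ⟪M (v t), v t⟫ + (∫ s in (0 : ℝ)..t, ⟪f s, u s⟫)
        = 1 / 2 * ⟪M u₀, u₀⟫ := by
  obtain ⟨R, hRG, hRb, hRadj, hRM, hMR⟩ := hG.exists_regularization hm hM hcoer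
  set ν := volume.restrict (Ioo 0 T) with hν
  have hui : Integrable u ν := hu.integrable one_le_two
  have hfi : Integrable f ν := hf.integrable one_le_two
  have hnn : Integrable (fun s => ‖f s‖ * ‖u s‖) ν := hf.norm.integrable_mul hu.norm
  set b : ℕ → ℝ → K := fun n t => ((n : ℝ) + 1) • (R n (M (u t)) - u t) + R n (f t) with hb
  have hRMu : ∀ n, Integrable (fun t => R n (M (u t))) ν := fun n =>
    ((R n).comp M).integrable_comp hui
  have hRf : ∀ n, Integrable (fun t => R n (f t)) ν := fun n => (R n).integrable_comp hfi
  have hbi : ∀ n, Integrable (b n) ν := fun n =>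
    (((hRMu n).sub hui).smul _).add (hRf n)
  have smul_int : ∀ {k : ℝ → ℝ} {w : ℝ → K}, Continuous k → Integrable w ν →
      Integrable (fun t => k t • w t) ν := fun {k w} hk hw =>
    (IntegrableOn.continuousOn_smul (K := Icc 0 T)
      ((integrableOn_Icc_iff_integrableOn_Ioo).2 hw) hk.continuousOn
      isCompact_Icc).mono_set Ioo_subset_Icc_self
  -- the regularized solution `R n M u` is the primitive of `-b n`
  set c : ℕ → ℝ → K := fun n t => R n (M u₀) + ∫ s in (0 : ℝ)..t, -b n s with hc
  have hcae : ∀ n, ∀ᵐ t ∂ν, c n t = R n (M (u t)) := by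
    intro n
    have := ae_eq_primitive_of_weak hT (v := fun t => R n (M (u t))) (b := b n)
      (v₀ := R n (M u₀)) (hRMu n) (hbi n) fun ζ hζ hζT => ?_
    · filter_upwards [this] with t ht
      rw [ht, hc]
      simp [sub_eq_add_neg]
    · have hd : Continuous (deriv ζ) := hζ.continuous_deriv (by simp)
      refine ext_inner_left ℝ fun z => ?_
      obtain ⟨p, hp, hp2, hpz⟩ := hRadj n z
      rw [inner_add_right, inner_neg_right, ← integral_inner (smul_int hd (hRMu n)),
        ← integral_inner (smul_int hζ.continuous (hbi n)), real_inner_smul_right, hpz,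
        ← hweak p hp ζ hζ hζT]
      congr 2
      · congr 1
        funext t
        rw [real_inner_smul_right, hpz]
      · funext t
        rw [real_inner_smul_right]
        congr 1
        simp only [hb, inner_add_right, real_inner_smul_right, inner_sub_right, hpz, hp2]
        rw [hM (u t), real_inner_comm (u t) z]
  have hcc : ∀ n, ContinuousOn (c n) (Icc 0 T) := fun n => by
    have hi : IntervalIntegrable (fun s => -b n s) volume 0 T := by
      rw [intervalIntegrable_iff_integrableOn_Ioo_of_le hT.le]
      exact (hbi n).neg
    have := intervalIntegral.continuousOn_primitive_interval' hi left_mem_uIcc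
    rw [uIcc_of_le hT.le] at this
    exact continuousOn_const.add this
  have hGn : ∀ n t, (R n (M (u t)), ((n : ℝ) + 1) • (M (u t) - M (R n (M (u t))))) ∈ G :=
    fun n t => hRG n (M (u t))
  have hMb : ∀ n t, M (-b n t)
      = ((n : ℝ) + 1) • (M (u t) - M (R n (M (u t)))) - M (R n (f t)) := fun n t => by
    simp only [hb, map_neg, map_add, map_smul, map_sub, smul_sub]; abel
  -- energy identity for the regularized solutions
  have energy : ∀ n, ∀ t ∈ Icc 0 T, ⟪M (c n t), c n t⟫ = ⟪M (R n (M u₀)), R n (M u₀)⟫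
      + 2 * ∫ s in (0 : ℝ)..t, -⟪M (R n (f s)), R n (M (u s))⟫ := by
    intro n t ht
    refine energy_primitive hM (g := fun s => -b n s) (hbi n).neg (R n (M u₀)) ?_ ht
    filter_upwards [hcae n] with s hs
    simp only [hc] at hs
    rw [hs, hMb, inner_sub_left, hG.inner_self_eq_zero (hGn n s), zero_sub]
  -- energy identity for the differences of regularized solutions
  have energy_sub : ∀ n k, ∀ t ∈ Icc 0 T, ⟪M (c n t - c k t), c n t - c k t⟫
      = ⟪M (R n (M u₀) - R k (M u₀)), R n (M u₀) - R k (M u₀)⟫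
      + 2 * ∫ s in (0 : ℝ)..t, -⟪M (R n (f s)) - M (R k (f s)),
          R n (M (u s)) - R k (M (u s))⟫ := by
    intro n k t ht
    have hI : ∀ n, ∀ t ∈ Icc 0 T, IntervalIntegrable (fun s => -b n s) volume 0 t :=
      fun n t ht => by
        rw [intervalIntegrable_iff_integrableOn_Ioo_of_le ht.1]
        exact IntegrableOn.mono_set (t := Ioo 0 T) (hbi n).neg (Ioo_subset_Ioo_right ht.2)
    have hdiff : ∀ t ∈ Icc 0 T, c n t - c k t
        = (R n (M u₀) - R k (M u₀)) + ∫ s in (0 : ℝ)..t, (-b n s - -b k s) := fun t ht => by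
      rw [intervalIntegral.integral_sub (hI n t ht) (hI k t ht)]
      simp only [hc]; abel
    rw [hdiff t ht]
    refine energy_primitive hM (g := fun s => -b n s - -b k s)
      ((hbi n).neg.sub (hbi k).neg) _ ?_ ht
    filter_upwards [hcae n, hcae k, ae_restrict_mem measurableSet_Ioo] with s hs1 hs2 hs
    rw [← hdiff s (Ioo_subset_Icc_self hs), hs1, hs2, map_sub, hMb, hMb, sub_sub_sub_comm,
      inner_sub_left]
    have := hG.inner_self_eq_zero (G.sub_mem (hGn n s) (hGn k s))
    simp only [Prod.fst_sub, Prod.snd_sub] at this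
    rw [this, zero_sub]
  -- the energy of the differences tends to zero uniformly on `[0,T]`
  set I : ℕ → ℝ := fun n => ∫ s in Ioo 0 T, ‖M (R n (f s)) - f s‖ * ‖u s‖ with hI
  have hbound : ∀ n s, ‖M (R n (f s)) - f s‖ ≤ (‖M‖ * m⁻¹ + 1) * ‖f s‖ := fun n s => by
    refine (norm_sub_le _ _).trans ?_
    have := (M.le_opNorm (R n (f s))).trans
      (mul_le_mul_of_nonneg_left (hRb n (f s)) (norm_nonneg M))
    linarith
  have hqm : ∀ n, AEStronglyMeasurable (fun s => ‖M (R n (f s)) - f s‖ * ‖u s‖) ν := fun n =>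
    ((M.integrable_comp (hRf n)).sub hfi).aestronglyMeasurable.norm.mul
      hui.aestronglyMeasurable.norm
  have hqb : ∀ n s, ‖M (R n (f s)) - f s‖ * ‖u s‖ ≤ (‖M‖ * m⁻¹ + 1) * (‖f s‖ * ‖u s‖) :=
    fun n s => by
      rw [← mul_assoc]
      exact mul_le_mul_of_nonneg_right (hbound n s) (norm_nonneg _)
  have hqi : ∀ n, Integrable (fun s => ‖M (R n (f s)) - f s‖ * ‖u s‖) ν := fun n =>
    (hnn.const_mul (‖M‖ * m⁻¹ + 1)).mono' (hqm n) (ae_of_all _ fun s => by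
      rw [Real.norm_of_nonneg (by positivity)]; exact hqb n s)
  have hIlim : Tendsto I atTop (𝓝 0) := by
    have := tendsto_integral_of_dominated_convergence (μ := ν)
      (F := fun n s => ‖M (R n (f s)) - f s‖ * ‖u s‖) (f := fun _ => (0 : ℝ))
      (fun s => (‖M‖ * m⁻¹ + 1) * (‖f s‖ * ‖u s‖)) hqm (hnn.const_mul _)
      (fun n => ae_of_all _ fun s => by
        rw [Real.norm_of_nonneg (by positivity)]; exact hqb n s)
      (ae_of_all _ fun s => by
        have := ((hMR (f s)).sub_const (f s)).norm.mul_const ‖u s‖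
        simpa using this)
    simpa using this
  set A : ℝ := m⁻¹ * ‖M‖ with hA
  have hA0 : 0 ≤ A := by positivity
  have hRMb : ∀ n x, ‖R n (M x)‖ ≤ A * ‖x‖ := fun n x => by
    refine (hRb n _).trans ?_
    rw [hA, mul_assoc]
    gcongr
    exact M.le_opNorm _
  set δ : ℕ → ℝ := fun n => m⁻¹ * (2 * ‖M‖ * ‖R n (M u₀) - u₀‖ ^ 2 + 4 * A * I n) with hδ
  have hδlim : Tendsto δ atTop (𝓝 0) := by
    have h1 := ((((hRM u₀).sub_const u₀).norm.pow 2).const_mul (2 * ‖M‖)).add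
      (hIlim.const_mul (4 * A))
    simpa using h1.const_mul m⁻¹
  have cauchy : ∀ n k, ∀ t ∈ Icc 0 T, ‖c n t - c k t‖ ^ 2 ≤ δ n + δ k := by
    intro n k t ht
    have h1 := hcoer (c n t - c k t)
    rw [energy_sub n k t ht] at h1
    have h2 : ⟪M (R n (M u₀) - R k (M u₀)), R n (M u₀) - R k (M u₀)⟫
        ≤ ‖M‖ * (2 * ‖R n (M u₀) - u₀‖ ^ 2 + 2 * ‖R k (M u₀) - u₀‖ ^ 2) := by
      refine (real_inner_le_norm _ _).trans ?_
      have e1 := M.le_opNorm (R n (M u₀) - R k (M u₀))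
      have e2 : ‖R n (M u₀) - R k (M u₀)‖ ≤ ‖R n (M u₀) - u₀‖ + ‖R k (M u₀) - u₀‖ := by
        rw [← sub_sub_sub_cancel_right _ _ u₀]; exact norm_sub_le _ _
      have e3 : ‖R n (M u₀) - R k (M u₀)‖ ^ 2
          ≤ 2 * ‖R n (M u₀) - u₀‖ ^ 2 + 2 * ‖R k (M u₀) - u₀‖ ^ 2 := by
        have := pow_le_pow_left₀ (norm_nonneg _) e2 2
        nlinarith [sq_nonneg (‖R n (M u₀) - u₀‖ - ‖R k (M u₀) - u₀‖)]
      calc _ ≤ ‖M‖ * ‖R n (M u₀) - R k (M u₀)‖ * ‖R n (M u₀) - R k (M u₀)‖ := by gcongr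
        _ = ‖M‖ * ‖R n (M u₀) - R k (M u₀)‖ ^ 2 := by ring
        _ ≤ _ := by gcongr
    have h3 : (∫ s in (0 : ℝ)..t, -⟪M (R n (f s)) - M (R k (f s)),
          R n (M (u s)) - R k (M (u s))⟫) ≤ 2 * A * (I n + I k) := by
      rw [intervalIntegral.integral_of_le ht.1, integral_Ioc_eq_integral_Ioo]
      have hqq := ((hqi n).add (hqi k)).const_mul (2 * A)
      refine (Real.le_norm_self _).trans ((norm_integral_le_of_norm_le
        (g := fun s => 2 * A * (‖M (R n (f s)) - f s‖ * ‖u s‖ + ‖M (R k (f s)) - f s‖ * ‖u s‖))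
        (IntegrableOn.mono_set hqq (Ioo_subset_Ioo_right ht.2))
        (ae_of_all _ fun s => ?_)).trans ?_)
      · rw [norm_neg]
        refine (norm_inner_le_norm _ _).trans ?_
        have e2 : ‖M (R n (f s)) - M (R k (f s))‖
            ≤ ‖M (R n (f s)) - f s‖ + ‖M (R k (f s)) - f s‖ := by
          rw [← sub_sub_sub_cancel_right _ _ (f s)]; exact norm_sub_le _ _
        have e3 : ‖R n (M (u s)) - R k (M (u s))‖ ≤ 2 * A * ‖u s‖ := by
          refine (norm_sub_le _ _).trans ?_
          linarith [hRMb n (u s), hRMb k (u s)]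
        calc _ ≤ (‖M (R n (f s)) - f s‖ + ‖M (R k (f s)) - f s‖) * (2 * A * ‖u s‖) := by
              gcongr
          _ = _ := by ring
      · have hle := setIntegral_mono_set (μ := volume) (s := Ioo 0 t) (t := Ioo 0 T) hqq
          (ae_of_all _ fun s => by
            simp only [Pi.zero_apply, Pi.add_apply]; positivity)
          (Ioo_subset_Ioo_right ht.2).eventuallyLE
        refine hle.trans (le_of_eq ?_)
        rw [integral_const_mul]
        congr 1
        exact integral_add (hqi n) (hqi k)
    have h4 : m * ‖c n t - c k t‖ ^ 2 ≤ m * (δ n + δ k) := by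
      have : m * (δ n + δ k) = 2 * ‖M‖ * ‖R n (M u₀) - u₀‖ ^ 2 + 4 * A * I n
          + (2 * ‖M‖ * ‖R k (M u₀) - u₀‖ ^ 2 + 4 * A * I k) := by
        simp only [hδ]
        rw [← mul_add, mul_inv_cancel_left₀ hm.ne']
      rw [this]
      linarith
    exact le_of_mul_le_mul_left h4 hm
  obtain ⟨v, hvc, hv⟩ := exists_continuousOn_tendsto hcc hδlim cauchy
  refine ⟨v, hvc, ?_, fun t ht => ?_⟩
  · filter_upwards [ae_all_iff.2 hcae, ae_restrict_mem measurableSet_Ioo] with t h1 h2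
    refine tendsto_nhds_unique (hv t (Ioo_subset_Icc_self h2)) ?_
    simpa only [h1] using hRM (u t)
  · have l1 : Tendsto (fun n => ⟪M (c n t), c n t⟫) atTop (𝓝 ⟪M (v t), v t⟫) :=
      ((M.continuous.tendsto _).comp (hv t ht)).inner (hv t ht)
    have l2 : Tendsto (fun n => ⟪M (R n (M u₀)), R n (M u₀)⟫) atTop (𝓝 ⟪M u₀, u₀⟫) :=
      ((M.continuous.tendsto _).comp (hRM u₀)).inner (hRM u₀)
    have l3 : Tendsto (fun n => ∫ s in (0 : ℝ)..t, -⟪M (R n (f s)), R n (M (u s))⟫) atTop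
        (𝓝 (∫ s in (0 : ℝ)..t, -⟪f s, u s⟫)) := by
      refine intervalIntegral.tendsto_integral_filter_of_dominated_convergence
        (fun s => ‖M‖ * m⁻¹ * A * (‖f s‖ * ‖u s‖)) (Eventually.of_forall fun n => ?_)
        (Eventually.of_forall fun n => ae_of_all _ fun s _ => ?_) ?_
        (ae_of_all _ fun s _ => ((hMR (f s)).inner (hRM (u s))).neg)
      · rw [uIoc_of_le ht.1, ← restrict_Ioo_eq_restrict_Ioc]
        refine AEStronglyMeasurable.mono_measure (μ := ν) ?_
          (Measure.restrict_mono (Ioo_subset_Ioo_right ht.2) le_rfl)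
        exact ((M.integrable_comp (hRf n)).aestronglyMeasurable.inner
          (hRMu n).aestronglyMeasurable).neg
      · rw [norm_neg]
        refine (norm_inner_le_norm _ _).trans ?_
        have e1 := (M.le_opNorm (R n (f s))).trans
          (mul_le_mul_of_nonneg_left (hRb n (f s)) (norm_nonneg M))
        calc _ ≤ (‖M‖ * (m⁻¹ * ‖f s‖)) * (A * ‖u s‖) := by
              gcongr; exact hRMb n _
          _ = _ := by ring
      · rw [intervalIntegrable_iff_integrableOn_Ioo_of_le ht.1]
        exact IntegrableOn.mono_set (t := Ioo 0 T) (hnn.const_mul _)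
          (Ioo_subset_Ioo_right ht.2)
    have l4 := l2.add (l3.const_mul 2)
    have := tendsto_nhds_unique (l1.congr fun n => energy n t ht) l4
    rw [this, intervalIntegral.integral_neg]
    ring

end Evolution

/-! ### Measurability of slices and of superpositions -/

section Measurability
open Filter Topology

/-- A weakly measurable map into a separable Hilbert space is strongly measurable. -/
theorem aestronglyMeasurable_of_inner {α K : Type*} [MeasurableSpace α] {τ : Measure α}
    [NormedAddCommGroup K] [InnerProductSpace ℝ K] [CompleteSpace K]
    [TopologicalSpace.SeparableSpace K] {F : α → K}
    (h : ∀ w : K, AEStronglyMeasurable (fun t => ⟪w, F t⟫) τ) : AEStronglyMeasurable F τ := by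
  set d := TopologicalSpace.denseSeq K
  set U : ℕ → Submodule ℝ K := fun n => Submodule.span ℝ (d '' Iic n) with hU
  have hfin : ∀ n, FiniteDimensional ℝ (U n) := fun n =>
    FiniteDimensional.span_of_finite ℝ ((finite_Iic n).image d)
  have hmono : Monotone U := fun n k hnk =>
    Submodule.span_mono (image_mono (Iic_subset_Iic.2 hnk))
  have hdense : ⊤ ≤ (⨆ n, U n).topologicalClosure := by
    rw [top_le_iff, ← Submodule.dense_iff_topologicalClosure_eq_top]
    refine (TopologicalSpace.denseRange_denseSeq K).mono ?_
    rintro _ ⟨n, rfl⟩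
    exact Submodule.mem_iSup_of_mem n (Submodule.subset_span ⟨n, self_mem_Iic, rfl⟩)
  refine aestronglyMeasurable_of_tendsto_ae atTop (f := fun n t => (U n).starProjection (F t))
    (fun n => ?_) (ae_of_all _ fun t => Submodule.starProjection_tendsto_self U hmono _ hdense)
  set b := stdOrthonormalBasis ℝ (U n)
  have : (fun t => (U n).starProjection (F t))
      = fun t => ∑ i, ⟪((b i : U n) : K), F t⟫ • ((b i : U n) : K) := by
    funext t
    rw [Submodule.starProjection_apply, b.orthogonalProjectionOnto_apply_eq_sum]
    simp
  rw [this]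
  exact Finset.aestronglyMeasurable_fun_sum _ fun i _ => (h _).smul_const _

theorem ae_memLp_two_slice {X Y E : Type*} [MeasurableSpace X] [MeasurableSpace Y]
    [NormedAddCommGroup E] {σ : Measure X} {τ : Measure Y} [SFinite σ] [SFinite τ]
    {g : X × Y → E} (hg : MemLp g 2 (σ.prod τ)) :
    ∀ᵐ t ∂τ, MemLp (fun x => g (x, t)) 2 σ := by
  have h1 := ((memLp_two_iff_integrable_sq_norm hg.1).1 hg).prod_left_ae
  filter_upwards [h1, hg.1.prod_swap.prodMk_left] with t ht hm
  exact (memLp_two_iff_integrable_sq_norm hm).2 ht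

/-- A square integrable function of `(x, t)` is a square integrable function of `t` with values in
the square integrable functions of `x`. -/
theorem exists_memLp_slice {X Y E : Type*} [MeasurableSpace X] [MeasurableSpace Y]
    [NormedAddCommGroup E] [InnerProductSpace ℝ E] [CompleteSpace E]
    {σ : Measure X} {τ : Measure Y} [SFinite σ] [SFinite τ]
    [TopologicalSpace.SeparableSpace (Lp E 2 σ)]
    {g : X × Y → E} (hg : MemLp g 2 (σ.prod τ)) :
    ∃ U : Y → Lp E 2 σ, MemLp U 2 τ ∧ ∀ᵐ t ∂τ, ∀ᵐ x ∂σ, U t x = g (x, t) := by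
  classical
  set U : Y → Lp E 2 σ := fun t =>
    if h : MemLp (fun x => g (x, t)) 2 σ then h.toLp else 0 with hU
  have hUae : ∀ᵐ t ∂τ, ∀ᵐ x ∂σ, U t x = g (x, t) := by
    filter_upwards [ae_memLp_two_slice hg] with t ht
    simp only [hU, dif_pos ht]
    exact ht.coeFn_toLp
  have hUm : AEStronglyMeasurable U τ := by
    refine aestronglyMeasurable_of_inner fun w => ?_
    have hw : AEStronglyMeasurable (fun z : Y × X => ⟪w z.2, g (z.2, z.1)⟫) (τ.prod σ) :=
      ((Lp.aestronglyMeasurable w).comp_snd).inner hg.1.prod_swap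
    refine hw.integral_prod_right'.congr ?_
    filter_upwards [hUae] with t ht
    rw [L2.inner_def]
    refine integral_congr_ae ?_
    filter_upwards [ht] with x hx
    rw [hx]
  refine ⟨U, (memLp_two_iff_integrable_sq_norm hUm).2 ?_, hUae⟩
  refine ((memLp_two_iff_integrable_sq_norm hg.1).1 hg).integral_prod_right.congr ?_
  filter_upwards [hUae] with t ht
  rw [← real_inner_self_eq_norm_sq, L2.inner_def]
  refine integral_congr_ae ?_
  filter_upwards [ht] with x hx
  rw [hx, real_inner_self_eq_norm_sq]

/-- Superposition with a Carathéodory function preserves measurability. -/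
theorem aestronglyMeasurable_superposition {X E F : Type*} [MeasurableSpace X] {σ : Measure X}
    [TopologicalSpace E] [TopologicalSpace F] [TopologicalSpace.PseudoMetrizableSpace F]
    {j : X → E → F} (hj : ∀ ξ, AEStronglyMeasurable (fun z => j z ξ) σ)
    (hjc : ∀ᵐ z ∂σ, Continuous (j z)) {e : X → E} (he : AEStronglyMeasurable e σ) :
    AEStronglyMeasurable (fun z => j z (e z)) σ := by
  have hs : ∀ s : SimpleFunc X E, AEStronglyMeasurable (fun z => j z (s z)) σ := by
    intro s
    have hcover : (⋃ y : s.range, s ⁻¹' {y.1}) = univ := by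
      refine eq_univ_of_forall fun z => mem_iUnion.2 ⟨⟨s z, s.mem_range_self z⟩, rfl⟩
    rw [← Measure.restrict_univ (μ := σ), ← hcover]
    refine AEStronglyMeasurable.iUnion fun y => ((hj y.1).restrict).congr ?_
    filter_upwards [ae_restrict_mem (s.measurableSet_fiber y.1)] with z hz
    rw [mem_preimage, mem_singleton_iff] at hz
    rw [hz]
  refine aestronglyMeasurable_of_tendsto_ae atTop
    (f := fun n z => j z (he.stronglyMeasurable_mk.approx n z)) (fun n => hs _) ?_
  filter_upwards [hjc, he.ae_eq_mk] with z hz hez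
  rw [hez]
  exact (hz.tendsto _).comp (he.stronglyMeasurable_mk.tendsto_approx z)

end Measurability

/-! ### Multiplication by material matrices -/

section Multiplication

theorem matVec_apply (A : Matrix (Fin 3) (Fin 3) ℝ) (v : R3) (i : Fin 3) :
    matVec A v i = ∑ k, A i k * v k := rfl

theorem matVec_add (A : Matrix (Fin 3) (Fin 3) ℝ) (v w : R3) :
    matVec A (v + w) = matVec A v + matVec A w := by
  ext i
  simp [matVec_apply, mul_add, Finset.sum_add_distrib]

theorem matVec_smul (A : Matrix (Fin 3) (Fin 3) ℝ) (c : ℝ) (v : R3) :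
    matVec A (c • v) = c • matVec A v := by
  ext i
  simp only [matVec_apply, PiLp.smul_apply, smul_eq_mul, Finset.mul_sum]
  exact Finset.sum_congr rfl fun k _ => by ring

theorem inner_matVec {A : Matrix (Fin 3) (Fin 3) ℝ} (hA : A.IsSymm) (v w : R3) :
    ⟪matVec A v, w⟫ = ⟪v, matVec A w⟫ := by
  have h : ∀ i k, A i k = A k i := fun i k => hA.apply k i
  simp only [PiLp.inner_apply, matVec_apply, Fin.sum_univ_three, RCLike.inner_apply, conj_trivial]
  rw [h 1 0, h 2 0, h 2 1]
  ring

theorem norm_matVec_le {A : Matrix (Fin 3) (Fin 3) ℝ} {M : ℝ} (hA : ∀ i k, |A i k| ≤ M) (v : R3) :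
    ‖matVec A v‖ ≤ 9 * M * ‖v‖ := by
  have hM : 0 ≤ M := (abs_nonneg _).trans (hA 0 0)
  have hi : ∀ i, |matVec A v i| ≤ 3 * M * ‖v‖ := fun i => by
    rw [matVec_apply]
    refine (Finset.abs_sum_le_sum_abs _ _).trans ?_
    have : ∀ k ∈ Finset.univ, |A i k * v k| ≤ M * ‖v‖ := fun k _ => by
      rw [abs_mul]
      have := PiLp.norm_apply_le v k
      rw [Real.norm_eq_abs] at this
      exact mul_le_mul (hA i k) this (abs_nonneg _) hM
    refine (Finset.sum_le_sum this).trans (le_of_eq ?_)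
    simp; ring
  refine le_of_sq_le_sq ?_ (by positivity)
  rw [EuclideanSpace.norm_sq_eq]
  have hi2 : ∀ i ∈ Finset.univ, ‖matVec A v i‖ ^ 2 ≤ (3 * M * ‖v‖) ^ 2 := fun i _ =>
    pow_le_pow_left₀ (norm_nonneg _) (hi i) 2
  refine (Finset.sum_le_sum hi2).trans ?_
  simp only [Finset.sum_const, Finset.card_univ, Fintype.card_fin, nsmul_eq_mul]
  have : 0 ≤ (M * ‖v‖) ^ 2 := by positivity
  push_cast
  nlinarith

theorem aestronglyMeasurable_matVec {X : Type*} [MeasurableSpace X] {σ : Measure X}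
    {A : X → Matrix (Fin 3) (Fin 3) ℝ} (hA : ∀ i k, AEStronglyMeasurable (fun x => A x i k) σ)
    {u : X → R3} (hu : AEStronglyMeasurable u σ) :
    AEStronglyMeasurable (fun x => matVec (A x) (u x)) σ := by
  have h : ∀ i, AEStronglyMeasurable (fun x => matVec (A x) (u x) i) σ := fun i => by
    simp only [matVec_apply]
    exact Finset.aestronglyMeasurable_fun_sum _ fun k _ => (hA i k).mul
      ((EuclideanSpace.proj k : R3 →L[ℝ] ℝ).continuous.comp_aestronglyMeasurable hu)
  have h2 : AEMeasurable (fun x i => matVec (A x) (u x) i) σ :=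
    aemeasurable_pi_lambda _ fun i => (h i).aemeasurable
  exact (PiLp.continuous_toLp 2 (fun _ : Fin 3 => ℝ)).comp_aestronglyMeasurable
    h2.aestronglyMeasurable

/-- Multiplication by a material matrix is a bounded, symmetric and coercive operator of
`L²(Ω)³`. -/
theorem IsMaterialMatrix.exists_mulOperator {Ω : Set R3} (hΩ : MeasurableSet Ω)
    {A : R3 → Matrix (Fin 3) (Fin 3) ℝ} (hA : IsMaterialMatrix Ω A) :
    ∃ (E : L2 Ω →L[ℝ] L2 Ω) (a : ℝ), 0 < a ∧
      (∀ u : L2 Ω, ∀ᵐ x ∂(volume.restrict Ω), E u x = matVec (A x) (u x)) ∧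
      (∀ u v, ⟪E u, v⟫ = ⟪u, E v⟫) ∧ ∀ u, a * ‖u‖ ^ 2 ≤ ⟪E u, u⟫ := by
  obtain ⟨M, hM⟩ := hA.bounded
  obtain ⟨a, ha, hpos⟩ := hA.posDef
  have hb : ∀ u : L2 Ω, ∀ᵐ x ∂(volume.restrict Ω), ‖matVec (A x) (u x)‖ ≤ 9 * |M| * ‖u x‖ :=
    fun u => by
      filter_upwards [ae_restrict_mem hΩ] with x hx
      exact norm_matVec_le (fun i k => (hM x hx i k).trans (le_abs_self M)) _
  have hmem : ∀ u : L2 Ω, MemLp (fun x => matVec (A x) (u x)) 2 (volume.restrict Ω) := fun u =>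
    (Lp.memLp u).of_le_mul (aestronglyMeasurable_matVec hA.measurable (Lp.aestronglyMeasurable u))
      (hb u)
  set E₀ : L2 Ω →ₗ[ℝ] L2 Ω :=
    { toFun := fun u => (hmem u).toLp
      map_add' := fun u v => by
        rw [← MemLp.toLp_add]
        refine MemLp.toLp_congr _ _ ?_
        filter_upwards [Lp.coeFn_add u v] with x hx
        rw [hx, Pi.add_apply, Pi.add_apply, matVec_add]
      map_smul' := fun c u => by
        rw [RingHom.id_apply, ← MemLp.toLp_const_smul]
        refine MemLp.toLp_congr _ _ ?_
        filter_upwards [Lp.coeFn_smul c u] with x hx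
        rw [hx, Pi.smul_apply, Pi.smul_apply, matVec_smul] } with hE₀
  have hE : ∀ u : L2 Ω, ∀ᵐ x ∂(volume.restrict Ω), E₀ u x = matVec (A x) (u x) := fun u =>
    (hmem u).coeFn_toLp
  refine ⟨E₀.mkContinuous (9 * |M|) fun u => ?_, a, ha, hE, fun u v => ?_, fun u => ?_⟩
  · refine Lp.norm_le_mul_norm_of_ae_le_mul ?_
    filter_upwards [hE u, hb u] with x h1 h2
    rwa [h1]
  · rw [LinearMap.mkContinuous_apply, LinearMap.mkContinuous_apply, L2.inner_def, L2.inner_def]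
    refine integral_congr_ae ?_
    filter_upwards [hE u, hE v, ae_restrict_mem hΩ] with x h1 h2 hx
    rw [h1, h2, inner_matVec (hA.symmetric x hx)]
  · rw [LinearMap.mkContinuous_apply, ← real_inner_self_eq_norm_sq, L2.inner_def, L2.inner_def,
      ← integral_const_mul]
    refine integral_mono_ae ((L2.integrable_inner (𝕜 := ℝ) u u).const_mul a)
      (L2.integrable_inner (𝕜 := ℝ) (E₀ u) u) ?_
    filter_upwards [hE u, ae_restrict_mem hΩ] with x h1 hx
    rw [h1, real_inner_self_eq_norm_sq]
    exact hpos x hx _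

end Multiplication

/-! ### The curl operators and the Maxwell operator -/

section Curl

variable {Ω : Set R3}

theorem continuous_partialD {φ : R3 → R3} (h : ContDiff ℝ ∞ φ) (i k : Fin 3) :
    Continuous (partialD φ i k) :=
  (EuclideanSpace.proj k : R3 →L[ℝ] ℝ).continuous.comp
    ((h.continuous_fderiv (by simp)).clm_apply continuous_const)

/-- Integration by parts for components of compactly supported smooth vector fields, with the
integrability of the integrand. -/
theorem integrable_and_integral_partialD_eq_zero {φ χ : R3 → R3} (hφ : ContDiff ℝ ∞ φ)
    (hφc : HasCompactSupport φ) (hχ : ContDiff ℝ ∞ χ) (hχc : HasCompactSupport χ)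
    (i k j : Fin 3) :
    Integrable (fun x => φ x i * partialD χ k j x + partialD φ k i x * χ x j) ∧
      ∫ x, (φ x i * partialD χ k j x + partialD φ k i x * χ x j) = 0 := by
  have comp : ∀ {ψ : R3 → R3}, ContDiff ℝ ∞ ψ → ∀ l, Differentiable ℝ (fun x => ψ x l) ∧
      Continuous (fun x => ψ x l) ∧
      ∀ x, fderiv ℝ (fun x => ψ x l) x (EuclideanSpace.single k 1) = partialD ψ k l x :=
    fun {ψ} hψ l => by
      have hd := hψ.differentiable (by simp)
      refine ⟨fun x => (EuclideanSpace.proj l : R3 →L[ℝ] ℝ).differentiableAt.comp x (hd x),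
        (EuclideanSpace.proj l : R3 →L[ℝ] ℝ).continuous.comp hψ.continuous, fun x => ?_⟩
      have := ((EuclideanSpace.proj l : R3 →L[ℝ] ℝ).hasFDerivAt.comp x (hd x).hasFDerivAt).fderiv
      change fderiv ℝ ((EuclideanSpace.proj l : R3 →L[ℝ] ℝ) ∘ ψ) x _ = _
      rw [this]
      rfl
  have supp : ∀ {ψ : R3 → R3}, HasCompactSupport ψ → ∀ l, HasCompactSupport (fun x => ψ x l) :=
    fun {ψ} hψ l => hψ.comp_left (g := fun v : R3 => v l) rfl
  obtain ⟨dφ, cφ, eφ⟩ := comp hφ i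
  obtain ⟨dχ, cχ, eχ⟩ := comp hχ j
  have i1 : Integrable (fun x => φ x i * partialD χ k j x) :=
    (cφ.mul (continuous_partialD hχ k j)).integrable_of_hasCompactSupport (supp hφc i).mul_right
  have i2 : Integrable (fun x => partialD φ k i x * χ x j) :=
    ((continuous_partialD hφ k i).mul cχ).integrable_of_hasCompactSupport (supp hχc j).mul_left
  have i3 : Integrable (fun x => φ x i * χ x j) :=
    (cφ.mul cχ).integrable_of_hasCompactSupport (supp hφc i).mul_right
  refine ⟨i1.add i2, ?_⟩
  rw [integral_add i1 i2]
  have := integral_mul_fderiv_eq_neg_fderiv_mul_of_integrable (μ := volume)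
    (f := fun x => φ x i) (g := fun x => χ x j) (v := EuclideanSpace.single k 1)
    (by simpa only [eφ] using i2) (by simpa only [eχ] using i1) i3 (fun x _ => dφ x)
    (fun x _ => dχ x)
  simp only [eφ, eχ] at this
  rw [this, neg_add_cancel]

/-- The classical curl is formally self-adjoint. -/
theorem integral_inner_classicalCurl {φ χ : R3 → R3} (hφ : ContDiff ℝ ∞ φ)
    (hφc : HasCompactSupport φ) (hχ : ContDiff ℝ ∞ χ) (hχc : HasCompactSupport χ) :
    ∫ x, ⟪φ x, classicalCurl χ x⟫ = ∫ x, ⟪classicalCurl φ x, χ x⟫ := by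
  have iφ : Integrable (fun x => ⟪φ x, classicalCurl χ x⟫) :=
    (hφ.continuous.inner (continuous_classicalCurl hχ)).integrable_of_hasCompactSupport
      (hφc.mono fun x hx h0 => hx (by simp [h0]))
  have iχ : Integrable (fun x => ⟪classicalCurl φ x, χ x⟫) :=
    ((continuous_classicalCurl hφ).inner hχ.continuous).integrable_of_hasCompactSupport
      (hχc.mono fun x hx h0 => hx (by simp [h0]))
  -- `⟪φ, curl χ⟫ - ⟪curl φ, χ⟫` is a combination of the exact derivatives `∂ₖ (φ i * χ j)`
  have P := fun i k j => integrable_and_integral_partialD_eq_zero hφ hφc hχ hχc i k j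
  set p : Fin 3 → Fin 3 → Fin 3 → R3 → ℝ := fun i k j x =>
    φ x i * partialD χ k j x + partialD φ k i x * χ x j with hp
  have hpi : ∀ i k j, Integrable (p i k j) := fun i k j => (P i k j).1
  have hp0 : ∀ i k j, ∫ x, p i k j x = 0 := fun i k j => (P i k j).2
  rw [← sub_eq_zero, ← integral_sub iφ iχ]
  have e : (fun x => ⟪φ x, classicalCurl χ x⟫ - ⟪classicalCurl φ x, χ x⟫) = fun x =>
      (p 0 1 2 x - p 0 2 1 x) + ((p 1 2 0 x - p 1 0 2 x) + (p 2 0 1 x - p 2 1 0 x)) := by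
    funext x
    simp only [PiLp.inner_apply, Fin.sum_univ_three, RCLike.inner_apply, conj_trivial,
      classicalCurl, hp, Matrix.cons_val_zero, Matrix.cons_val_one, Matrix.cons_val]
    ring
  have hd : ∀ i k j i' k' j', Integrable (fun x => p i k j x - p i' k' j' x) ∧
      ∫ x, (p i k j x - p i' k' j' x) = 0 := fun i k j i' k' j' =>
    ⟨(hpi i k j).sub (hpi i' k' j'), by
      rw [integral_sub (hpi i k j) (hpi i' k' j'), hp0, hp0, sub_zero]⟩
  have hd2 : Integrable (fun x => (p 1 2 0 x - p 1 0 2 x) + (p 2 0 1 x - p 2 1 0 x)) :=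
    (hd _ _ _ _ _ _).1.add (hd _ _ _ _ _ _).1
  rw [e, integral_add (hd _ _ _ _ _ _).1 hd2,
    integral_add (hd _ _ _ _ _ _).1 (hd _ _ _ _ _ _).1, (hd _ _ _ _ _ _).2, (hd _ _ _ _ _ _).2,
    (hd _ _ _ _ _ _).2]
  simp

namespace IsTestVectorField

variable {φ : R3 → R3}

theorem memLp (h : IsTestVectorField Ω φ) : MemLp φ 2 (volume.restrict Ω) :=
  h.contDiff.continuous.memLp_of_hasCompactSupport h.hasCompactSupport

theorem memLp_curl (h : IsTestVectorField Ω φ) :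
    MemLp (classicalCurl φ) 2 (volume.restrict Ω) :=
  (continuous_classicalCurl h.contDiff).memLp_of_hasCompactSupport
    (hasCompactSupport_classicalCurl h.hasCompactSupport)

theorem eq_zero_of_notMem (h : IsTestVectorField Ω φ) {x : R3} (hx : x ∉ Ω) : φ x = 0 :=
  image_eq_zero_of_notMem_tsupport fun h' => hx (h.tsupport_subset h')

end IsTestVectorField

theorem inner_toLp {f : R3 → R3} (u : L2 Ω) (hf : MemLp f 2 (volume.restrict Ω)) :
    ⟪u, hf.toLp⟫ = ∫ x in Ω, ⟪u x, f x⟫ := by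
  rw [L2.inner_def]
  refine integral_congr_ae ?_
  filter_upwards [hf.coeFn_toLp] with x hx
  rw [hx]

theorem isWeakCurl_iff {u F : L2 Ω} : IsWeakCurl Ω u F ↔
    ∀ (φ : R3 → R3) (hφ : IsTestVectorField Ω φ),
      ⟪u, hφ.memLp_curl.toLp⟫ = ⟪F, hφ.memLp.toLp⟫ := by
  unfold IsWeakCurl
  simp only [inner_toLp]

theorem IsTestVectorField.isWeakCurl {φ : R3 → R3} (h : IsTestVectorField Ω φ) :
    IsWeakCurl Ω h.memLp.toLp h.memLp_curl.toLp := by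
  intro χ hχ
  have e1 : ∫ x in Ω, ⟪(h.memLp.toLp : L2 Ω) x, classicalCurl χ x⟫
      = ∫ x, ⟪φ x, classicalCurl χ x⟫ := by
    rw [← setIntegral_eq_integral_of_forall_compl_eq_zero (s := Ω)
      (f := fun x => ⟪φ x, classicalCurl χ x⟫) (fun x hx => by rw [h.eq_zero_of_notMem hx, inner_zero_left])]
    refine integral_congr_ae ?_
    filter_upwards [h.memLp.coeFn_toLp] with x hx
    rw [hx]
  have e2 : ∫ x in Ω, ⟪(h.memLp_curl.toLp : L2 Ω) x, χ x⟫
      = ∫ x, ⟪classicalCurl φ x, χ x⟫ := by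
    rw [← setIntegral_eq_integral_of_forall_compl_eq_zero (s := Ω)
      (f := fun x => ⟪classicalCurl φ x, χ x⟫) (fun x hx => by rw [hχ.eq_zero_of_notMem hx, inner_zero_right])]
    refine integral_congr_ae ?_
    filter_upwards [h.memLp_curl.coeFn_toLp] with x hx
    rw [hx]
  rw [e1, e2]
  exact integral_inner_classicalCurl h.contDiff h.hasCompactSupport hχ.contDiff
    hχ.hasCompactSupport

/-- The element of `V` given by a field with a weak curl. -/
def Hcurl.mk (u F : L2 Ω) (h : IsWeakCurl Ω u F) : Hcurl Ω := ⟨WithLp.toLp 2 (u, F), h⟩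

@[simp] theorem fieldOf_mk (u F : L2 Ω) (h : IsWeakCurl Ω u F) : fieldOf (Hcurl.mk u F h) = u := rfl

@[simp] theorem curlOf_mk (u F : L2 Ω) (h : IsWeakCurl Ω u F) : curlOf (Hcurl.mk u F h) = F := rfl

theorem isWeakCurl_of_mem (u : Hcurl Ω) : IsWeakCurl Ω (fieldOf u) (curlOf u) := u.2

/-- Test fields belong to `V₀`. -/
theorem IsTestVectorField.mk_mem_Hcurl0 {φ : R3 → R3} (h : IsTestVectorField Ω φ) :
    Hcurl.mk _ _ h.isWeakCurl ∈ Hcurl0 Ω := by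
  intro ψ
  rw [curlOf_mk, fieldOf_mk, real_inner_comm, real_inner_comm (curlOf ψ)]
  exact isWeakCurl_iff.1 (isWeakCurl_of_mem ψ) φ h

/-- The weak curl is unique. -/
theorem IsWeakCurl.eq_zero (hΩ : IsOpen Ω) {F : L2 Ω} (h : IsWeakCurl Ω 0 F) : F = 0 := by
  have hF : LocallyIntegrableOn (fun x => F x) Ω volume :=
    locallyIntegrableOn_of_locallyIntegrable_restrict
      ((Lp.memLp F).locallyIntegrable one_le_two)
  have key : ∀ᵐ x, x ∈ Ω → F x = 0 := by
    refine hΩ.ae_eq_zero_of_integral_contDiff_smul_eq_zero hF fun g hg hgc hgs => ?_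
    have hgi : Integrable (fun x => g x • F x) (volume.restrict Ω) :=
      ((Lp.memLp F).locallyIntegrable one_le_two).integrable_smul_left_of_hasCompactSupport
        hg.continuous hgc
    rw [← setIntegral_eq_integral_of_forall_compl_eq_zero (s := Ω) (fun x hx => by
      rw [image_eq_zero_of_notMem_tsupport fun h' => hx (hgs h'), zero_smul])]
    refine ext_inner_left ℝ fun c => ?_
    rw [← integral_inner hgi, inner_zero_right]
    have ht : IsTestVectorField Ω (fun x => g x • c) :=
      ⟨hg.smul contDiff_const, hgc.smul_right, (tsupport_smul_subset_left g _).trans hgs⟩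
    have h1 := isWeakCurl_iff.1 h _ ht
    rw [inner_zero_left, inner_toLp] at h1
    rw [h1]
    refine integral_congr_ae (ae_of_all _ fun x => ?_)
    simp only [real_inner_smul_right]
    rw [real_inner_comm]
  rw [Lp.eq_zero_iff_ae_eq_zero]
  exact (ae_restrict_iff' hΩ.measurableSet).2 key

/-- The graph of the Maxwell operator `(Φ, Ψ) ↦ (curl Ψ, -curl Φ)` with domain `V₀ × V` in
`L²(Ω)³ ⊕ L²(Ω)³`. -/
def maxwellGraph (Ω : Set R3) :
    Submodule ℝ (WithLp 2 (L2 Ω × L2 Ω) × WithLp 2 (L2 Ω × L2 Ω)) where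
  carrier := {p | ∃ Φ ∈ Hcurl0 Ω, ∃ Ψ : Hcurl Ω,
    p = (WithLp.toLp 2 (fieldOf Φ, fieldOf Ψ), WithLp.toLp 2 (curlOf Ψ, -curlOf Φ))}
  zero_mem' := ⟨0, zero_mem _, 0, by simp [fieldOf, curlOf]; rfl⟩
  add_mem' := by
    rintro _ _ ⟨Φ, hΦ, Ψ, rfl⟩ ⟨Φ', hΦ', Ψ', rfl⟩
    refine ⟨Φ + Φ', add_mem hΦ hΦ', Ψ + Ψ', ?_⟩
    simp only [Prod.mk_add_mk, ← WithLp.toLp_add, ← neg_add]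
    rfl
  smul_mem' := by
    rintro c _ ⟨Φ, hΦ, Ψ, rfl⟩
    refine ⟨c • Φ, Submodule.smul_mem _ c hΦ, c • Ψ, ?_⟩
    simp only [Prod.smul_mk, ← WithLp.toLp_smul, smul_neg]
    rfl

/-- The Maxwell operator is skew-adjoint: `V₀` is by definition the domain of the adjoint of the
curl on `V`, and `V` is the domain of the adjoint of the curl on `V₀`, as `V₀` contains the test
fields. -/
theorem isSkewAdjointGraph_maxwellGraph (hΩ : IsOpen Ω) :
    IsSkewAdjointGraph (maxwellGraph Ω) where
  mem_iff := by
    rintro ⟨x, y⟩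
    constructor
    · rintro ⟨Φ, hΦ, Ψ, hp⟩ q ⟨Φ', hΦ', Ψ', rfl⟩
      obtain ⟨rfl, rfl⟩ := Prod.mk.inj hp
      simp only [WithLp.prod_inner_apply, inner_neg_left, inner_neg_right]
      rw [hΦ Ψ', real_inner_comm (fieldOf Φ') (curlOf Ψ), ← hΦ' Ψ,
        real_inner_comm (fieldOf Ψ) (curlOf Φ')]
      ring
    · intro h
      have h' : ∀ Φ ∈ Hcurl0 Ω, ∀ Ψ : Hcurl Ω,
          ⟪y.fst, fieldOf Φ⟫ + ⟪y.snd, fieldOf Ψ⟫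
            = -(⟪x.fst, curlOf Ψ⟫ + ⟪x.snd, -curlOf Φ⟫) := fun Φ hΦ Ψ => by
        have := h _ ⟨Φ, hΦ, Ψ, rfl⟩
        simp only [WithLp.prod_inner_apply] at this
        exact this
      have f0 : fieldOf (0 : Hcurl Ω) = 0 := rfl
      have c0 : curlOf (0 : Hcurl Ω) = 0 := rfl
      have h1 : ∀ Φ ∈ Hcurl0 Ω, ⟪x.snd, curlOf Φ⟫ = ⟪y.fst, fieldOf Φ⟫ := fun Φ hΦ => by
        have := h' Φ hΦ 0
        simp only [f0, c0, inner_zero_right, inner_neg_right] at this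
        linarith
      have h2 : ∀ Ψ : Hcurl Ω, ⟪x.fst, curlOf Ψ⟫ = ⟪-y.snd, fieldOf Ψ⟫ := fun Ψ => by
        have := h' 0 (zero_mem _) Ψ
        simp only [f0, c0, inner_zero_right, neg_zero] at this
        rw [inner_neg_left]
        linarith
      have w1 : IsWeakCurl Ω x.snd y.fst := isWeakCurl_iff.2 fun φ hφ =>
        h1 _ hφ.mk_mem_Hcurl0
      have w2 : IsWeakCurl Ω x.fst (-y.snd) := isWeakCurl_iff.2 fun φ hφ =>
        h2 (Hcurl.mk _ _ hφ.isWeakCurl)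
      exact ⟨Hcurl.mk _ _ w2, fun ψ => (h2 ψ).symm, Hcurl.mk _ _ w1, by
        rw [fieldOf_mk, fieldOf_mk, curlOf_mk, curlOf_mk, neg_neg]; rfl⟩
  eq_zero := by
    rintro y ⟨Φ, -, Ψ, hp⟩
    obtain ⟨hx, rfl⟩ := Prod.mk.inj hp
    have hΦ : fieldOf Φ = 0 := (congrArg (fun z => z.fst) hx).symm
    have hΨ : fieldOf Ψ = 0 := (congrArg (fun z => z.snd) hx).symm
    have w1 := isWeakCurl_of_mem Φ
    have w2 := isWeakCurl_of_mem Ψ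
    rw [hΦ] at w1
    rw [hΨ] at w2
    rw [w1.eq_zero hΩ, w2.eq_zero hΩ, neg_zero]
    rfl

end Curl

/-! ### Weak solutions -/

section WeakSolution
open Filter Topology

variable {Ω : Set R3} {T : ℝ}

theorem integral_deriv_mul_eq_neg {η ζ : ℝ → ℝ} (hT : 0 < T) (hη : ContDiff ℝ ∞ η)
    (hs : tsupport η ⊆ Ioo 0 T) (hζ : ContDiff ℝ ∞ ζ) :
    ∫ t in Ioo 0 T, deriv η t * ζ t = -∫ t in Ioo 0 T, η t * deriv ζ t := by
  have hd : ∀ {k : ℝ → ℝ}, ContDiff ℝ ∞ k → ∀ x, HasDerivAt k (deriv k x) x := fun hk x =>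
    ((hk.differentiable (by simp)) x).hasDerivAt
  have hc : ∀ {k : ℝ → ℝ}, ContDiff ℝ ∞ k → Continuous (deriv k) := fun hk =>
    hk.continuous_deriv (by simp)
  have h0 : η 0 = 0 := image_eq_zero_of_notMem_tsupport fun h => lt_irrefl _ (hs h).1
  have h1 : η T = 0 := image_eq_zero_of_notMem_tsupport fun h => lt_irrefl _ (hs h).2
  have := intervalIntegral.integral_mul_deriv_eq_deriv_mul (a := 0) (b := T)
    (fun x _ => hd hη x) (fun x _ => hd hζ x) ((hc hη).intervalIntegrable _ _)
    ((hc hζ).intervalIntegrable _ _)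
  rw [h0, h1, intervalIntegral.integral_of_le hT.le, intervalIntegral.integral_of_le hT.le,
    integral_Ioc_eq_integral_Ioo, integral_Ioc_eq_integral_Ioo] at this
  rw [this]; ring

/-- Products of a smooth scalar function of time that vanishes at `T` and a fixed element of `V`
are admissible test functions. -/
theorem isSpaceTimeTest_smul (hT : 0 < T) {ζ : ℝ → ℝ} (hζ : ContDiff ℝ ∞ ζ) (hζT : ζ T = 0)
    (w : Hcurl Ω) :
    IsSpaceTimeTest Ω T (fun t => ζ t • w) (fun t => deriv ζ t • fieldOf w)
      (fun t => ζ t • fieldOf w) := by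
  have hm : ∀ {E : Type} [NormedAddCommGroup E] [NormedSpace ℝ E] (y : E) {k : ℝ → ℝ},
      Continuous k → MemLp (fun t => k t • y) 2 (volume.restrict (Ioo 0 T)) :=
    fun {E} _ _ y {k} hk => by
      obtain ⟨C, hC⟩ := isCompact_Icc.exists_bound_of_continuousOn
        (s := Icc (0 : ℝ) T) hk.continuousOn
      refine MemLp.of_bound (hk.aestronglyMeasurable.smul_const y) (C * ‖y‖) ?_
      filter_upwards [ae_restrict_mem measurableSet_Ioo] with t ht
      rw [norm_smul]
      have := hC t (Ioo_subset_Icc_self ht)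
      gcongr
  have hc : Continuous (deriv ζ) := hζ.continuous_deriv (by simp)
  refine ⟨hm w hζ.continuous, hm (fieldOf w) hc, fun η hη hηc hηs => ?_,
    (hζ.continuous.smul continuous_const).continuousOn, ae_of_all _ fun t => rfl, by simp [hζT]⟩
  change (∫ t in Ioo 0 T, deriv η t • ζ t • fieldOf w)
    = -∫ t in Ioo 0 T, η t • deriv ζ t • fieldOf w
  simp only [smul_smul]
  rw [integral_smul_const, integral_smul_const, integral_deriv_mul_eq_neg hT hη hηs hζ, neg_smul]

theorem integral_inner_smul {u w : L2 Ω} {f : R3 → R3}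
    (h : ∀ᵐ x ∂(volume.restrict Ω), u x = f x) (c : ℝ) :
    ∫ x in Ω, ⟪f x, (c • w : L2 Ω) x⟫ = c * ⟪u, w⟫ := by
  rw [← real_inner_smul_right, L2.inner_def]
  refine integral_congr_ae ?_
  filter_upwards [h] with x hx
  rw [hx]

theorem integrable_mul_inner {ζ : ℝ → ℝ} (hζ : Continuous ζ) {F : ℝ → L2 Ω}
    (hF : Integrable F (volume.restrict (Ioo 0 T))) (w : L2 Ω) :
    Integrable (fun t => ζ t * ⟪F t, w⟫) (volume.restrict (Ioo 0 T)) := by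
  have h : Integrable (fun t => ⟪F t, w⟫) (volume.restrict (Ioo 0 T)) := hF.inner_const w
  exact (IntegrableOn.continuousOn_smul (K := Icc 0 T)
    ((integrableOn_Icc_iff_integrableOn_Ioo).2 h) hζ.continuousOn isCompact_Icc).mono_set
    Ioo_subset_Icc_self

theorem memLp_toLp_prodMk {α E F : Type*} [MeasurableSpace α] {τ : Measure α}
    [NormedAddCommGroup E] [NormedSpace ℝ E] [NormedAddCommGroup F] [NormedSpace ℝ F]
    {U : α → E} {V : α → F} (hU : MemLp U 2 τ) (hV : MemLp V 2 τ) :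
    MemLp (fun t => WithLp.toLp 2 (U t, V t)) 2 τ := by
  have hm : AEStronglyMeasurable (fun t => WithLp.toLp 2 (U t, V t)) τ :=
    (WithLp.prodContinuousLinearEquiv 2 ℝ E F).symm.continuous.comp_aestronglyMeasurable
      (hU.1.prodMk hV.1)
  rw [memLp_two_iff_integrable_sq_norm hm]
  simp only [WithLp.prod_norm_sq_eq_of_L2]
  exact ((memLp_two_iff_integrable_sq_norm hU.1).1 hU).add
    ((memLp_two_iff_integrable_sq_norm hV.1).1 hV)

/-- The operator `(x, y) ↦ (E x, N y)` inherits symmetry and coercivity from `E` and `N`. -/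
theorem exists_diagonal_operator {H : Type*} [NormedAddCommGroup H] [InnerProductSpace ℝ H]
    {E N : H →L[ℝ] H} {a b : ℝ} (ha : 0 < a) (hb : 0 < b)
    (hE : ∀ x y, ⟪E x, y⟫ = ⟪x, E y⟫) (hN : ∀ x y, ⟪N x, y⟫ = ⟪x, N y⟫)
    (hEa : ∀ x, a * ‖x‖ ^ 2 ≤ ⟪E x, x⟫) (hNb : ∀ x, b * ‖x‖ ^ 2 ≤ ⟪N x, x⟫) :
    ∃ (M : WithLp 2 (H × H) →L[ℝ] WithLp 2 (H × H)) (m : ℝ), 0 < m ∧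
      (∀ x, M x = WithLp.toLp 2 (E x.fst, N x.snd)) ∧
      (∀ x y, ⟪M x, y⟫ = ⟪x, M y⟫) ∧ ∀ x, m * ‖x‖ ^ 2 ≤ ⟪M x, x⟫ := by
  set e := WithLp.prodContinuousLinearEquiv 2 ℝ H H
  set M : WithLp 2 (H × H) →L[ℝ] WithLp 2 (H × H) :=
    (e.symm : H × H →L[ℝ] WithLp 2 (H × H)).comp
      ((E.prodMap N).comp (e : WithLp 2 (H × H) →L[ℝ] H × H))
  have hM : ∀ x, M x = WithLp.toLp 2 (E x.fst, N x.snd) := fun x => rfl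
  refine ⟨M, min a b, lt_min ha hb, hM, fun x y => ?_, fun x => ?_⟩
  · rw [hM, hM, WithLp.prod_inner_apply, WithLp.prod_inner_apply]
    exact congrArg₂ (· + ·) (hE _ _) (hN _ _)
  · rw [hM, WithLp.prod_inner_apply, WithLp.prod_norm_sq_eq_of_L2, mul_add]
    refine add_le_add (le_trans ?_ (hEa x.fst)) (le_trans ?_ (hNb x.snd))
    · gcongr; exact min_le_left _ _
    · gcongr; exact min_le_right _ _

/-- By the linear growth of `j₁`, the current `j(e)` is square integrable on `Q_T`. -/
theorem memLp_current {j₀ : R3 × ℝ → R3} {j₁ : R3 × ℝ → R3 → R3} (hΩ : MeasurableSet Ω)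
    (hj : IsCurrentDensity Ω T j₀ j₁) {e : R3 × ℝ → R3}
    (he : MemLp e 2 (volume.restrict (spaceTimeCylinder Ω T))) :
    MemLp (fun z => j₀ z + j₁ z (e z)) 2 (volume.restrict (spaceTimeCylinder Ω T)) := by
  obtain ⟨c₁, -, hc₁⟩ := hj.growth
  refine hj.memLp.add (he.of_le_mul (c := c₁)
    (aestronglyMeasurable_superposition hj.measurable hj.continuous he.1) ?_)
  filter_upwards [ae_restrict_mem (hΩ.prod measurableSet_Ioo)] with z hz
  exact hc₁ z hz _

theorem exists_slice {g : R3 × ℝ → R3}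
    (hg : MemLp g 2 (volume.restrict (spaceTimeCylinder Ω T))) :
    ∃ U : ℝ → L2 Ω, MemLp U 2 (volume.restrict (Ioo 0 T)) ∧
      ∀ᵐ t ∂(volume.restrict (Ioo 0 T)), ∀ᵐ x ∂(volume.restrict Ω), U t x = g (x, t) := by
  have : Fact ((2 : ENNReal) ≠ ⊤) := ⟨by simp⟩
  refine exists_memLp_slice ?_
  rwa [Measure.prod_restrict]

/-- The two weak equations together are the weak form of the abstract Cauchy problem for the
Maxwell operator. -/
theorem IsWeakSolution.abstract_weak_form {ε μ : R3 → Matrix (Fin 3) (Fin 3) ℝ} (hT : 0 < T)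
    {j : R3 × ℝ → R3 → R3} {e₀ h₀ : L2 Ω} {e h : R3 × ℝ → R3}
    (hsol : IsWeakSolution Ω T ε μ j e₀ h₀ e h)
    {E N : L2 Ω →L[ℝ] L2 Ω}
    (hE : ∀ u : L2 Ω, ∀ᵐ x ∂(volume.restrict Ω), E u x = matVec (ε x) (u x))
    (hN : ∀ u : L2 Ω, ∀ᵐ x ∂(volume.restrict Ω), N u x = matVec (μ x) (u x))
    {U V J : ℝ → L2 Ω} (hU : Integrable U (volume.restrict (Ioo 0 T)))
    (hV : Integrable V (volume.restrict (Ioo 0 T)))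
    (hJ : Integrable J (volume.restrict (Ioo 0 T)))
    (hUe : ∀ᵐ t ∂(volume.restrict (Ioo 0 T)), ∀ᵐ x ∂(volume.restrict Ω), U t x = e (x, t))
    (hVh : ∀ᵐ t ∂(volume.restrict (Ioo 0 T)), ∀ᵐ x ∂(volume.restrict Ω), V t x = h (x, t))
    (hJj : ∀ᵐ t ∂(volume.restrict (Ioo 0 T)), ∀ᵐ x ∂(volume.restrict Ω),
      J t x = j (x, t) (e (x, t)))
    {Φ : Hcurl Ω} (hΦ : Φ ∈ Hcurl0 Ω) (Ψ : Hcurl Ω) {ζ : ℝ → ℝ} (hζ : ContDiff ℝ ∞ ζ)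
    (hζT : ζ T = 0) :
    -(∫ t in Ioo 0 T, deriv ζ t * (⟪E (U t), fieldOf Φ⟫ + ⟪N (V t), fieldOf Ψ⟫))
      + (∫ t in Ioo 0 T, ζ t * (⟪U t, curlOf Ψ⟫ - ⟪V t, curlOf Φ⟫ + ⟪J t, fieldOf Φ⟫))
      = ζ 0 * (⟪E e₀, fieldOf Φ⟫ + ⟪N h₀, fieldOf Ψ⟫) := by
  have hd : Continuous (deriv ζ) := hζ.continuous_deriv (by simp)
  have A := hsol.ampere _ _ _ (isSpaceTimeTest_smul hT hζ hζT Φ)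
    (ae_of_all _ fun t => Submodule.smul_mem _ _ hΦ)
  have F := hsol.faraday _ _ _ (isSpaceTimeTest_smul hT hζ hζT Ψ)
  have sl : ∀ {B : L2 Ω →L[ℝ] L2 Ω} {A : R3 → Matrix (Fin 3) (Fin 3) ℝ} {W : ℝ → L2 Ω}
      {g : R3 × ℝ → R3} {w : L2 Ω},
      (∀ u : L2 Ω, ∀ᵐ x ∂(volume.restrict Ω), B u x = matVec (A x) (u x)) →
      (∀ᵐ t ∂(volume.restrict (Ioo 0 T)), ∀ᵐ x ∂(volume.restrict Ω), W t x = g (x, t)) →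
      ∫ t in Ioo 0 T, ∫ x in Ω, ⟪matVec (A x) (g (x, t)), (deriv ζ t • w : L2 Ω) x⟫
        = ∫ t in Ioo 0 T, deriv ζ t * ⟪B (W t), w⟫ := fun {B A W g w} hB hW => by
    refine integral_congr_ae ?_
    filter_upwards [hW] with t ht
    refine integral_inner_smul ?_ _
    filter_upwards [ht, hB (W t)] with x h1 h2
    rw [h2, h1]
  have A2 : ∫ t in Ioo 0 T, ∫ x in Ω, (-⟪h (x, t), (curlOf (ζ t • Φ)) x⟫
        + ⟪j (x, t) (e (x, t)), (fieldOf (ζ t • Φ)) x⟫)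
      = (∫ t in Ioo 0 T, ζ t * ⟪J t, fieldOf Φ⟫) - ∫ t in Ioo 0 T, ζ t * ⟪V t, curlOf Φ⟫ := by
    rw [← integral_sub (integrable_mul_inner hζ.continuous hJ _)
      (integrable_mul_inner hζ.continuous hV _)]
    refine integral_congr_ae ?_
    filter_upwards [hVh, hJj] with t h1 h2
    have i1 : Integrable (fun x => ⟪h (x, t), (ζ t • curlOf Φ : L2 Ω) x⟫) (volume.restrict Ω) :=
      (L2.integrable_inner (𝕜 := ℝ) (V t) (ζ t • curlOf Φ)).congr (by
        filter_upwards [h1] with x hx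
        rw [hx])
    have i2 : Integrable (fun x => ⟪j (x, t) (e (x, t)), (ζ t • fieldOf Φ : L2 Ω) x⟫)
        (volume.restrict Ω) :=
      (L2.integrable_inner (𝕜 := ℝ) (J t) (ζ t • fieldOf Φ)).congr (by
        filter_upwards [h2] with x hx
        rw [hx])
    change ∫ x in Ω, (-⟪h (x, t), (ζ t • curlOf Φ : L2 Ω) x⟫
      + ⟪j (x, t) (e (x, t)), (ζ t • fieldOf Φ : L2 Ω) x⟫) = _
    have i1' : Integrable (fun x => -⟪h (x, t), (ζ t • curlOf Φ : L2 Ω) x⟫)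
      (volume.restrict Ω) := i1.neg
    rw [integral_add i1' i2, integral_neg, integral_inner_smul h1, integral_inner_smul h2]
    ring
  have F2 : ∫ t in Ioo 0 T, ∫ x in Ω, ⟪e (x, t), (curlOf (ζ t • Ψ)) x⟫
      = ∫ t in Ioo 0 T, ζ t * ⟪U t, curlOf Ψ⟫ := by
    refine integral_congr_ae ?_
    filter_upwards [hUe] with t ht
    exact integral_inner_smul (w := curlOf Ψ) ht (ζ t)
  rw [sl hE hUe, A2, integral_inner_smul (hE e₀)] at A
  rw [sl hN hVh, F2, integral_inner_smul (hN h₀)] at F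
  have i1 := integrable_mul_inner hd (E.integrable_comp hU) (fieldOf Φ)
  have i2 := integrable_mul_inner hd (N.integrable_comp hV) (fieldOf Ψ)
  have i3 := integrable_mul_inner hζ.continuous hU (curlOf Ψ)
  have i4 := integrable_mul_inner hζ.continuous hV (curlOf Φ)
  have i5 := integrable_mul_inner hζ.continuous hJ (fieldOf Φ)
  have i34 : Integrable (fun t => ζ t * ⟪U t, curlOf Ψ⟫ - ζ t * ⟪V t, curlOf Φ⟫)
    (volume.restrict (Ioo 0 T)) := i3.sub i4
  simp only [mul_add, mul_sub]
  rw [integral_add i1 i2, integral_add i34 i5, integral_sub i3 i4]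
  linarith

theorem weightedNormSq_eq_inner {A : R3 → Matrix (Fin 3) (Fin 3) ℝ} {E : L2 Ω →L[ℝ] L2 Ω}
    (hE : ∀ u : L2 Ω, ∀ᵐ x ∂(volume.restrict Ω), E u x = matVec (A x) (u x)) (u : L2 Ω) :
    weightedNormSq Ω A u = ⟪E u, u⟫ := by
  rw [weightedNormSq, L2.inner_def]
  refine integral_congr_ae ?_
  filter_upwards [hE u] with x hx
  rw [hx]

/-- Continuous representatives are unique on `[0,T]`. -/
theorem IsContinuousRep.eqOn {u : R3 × ℝ → R3} {v w : ℝ → L2 Ω} (hT : 0 < T)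
    (hv : IsContinuousRep Ω T u v) (hw : IsContinuousRep Ω T u w) : EqOn v w (Icc 0 T) := by
  refine Measure.eqOn_Icc_of_ae_eq volume hT.ne ?_ hv.continuousOn hw.continuousOn
  rw [← restrict_Ioo_eq_restrict_Icc]
  filter_upwards [hv.ae_eq, hw.ae_eq] with t h1 h2
  refine Lp.ext ?_
  filter_upwards [h1, h2] with x hx1 hx2
  rw [hx1, hx2]

end WeakSolution

theorem theorem4p1 (Ω : Set R3) (hΩ : IsOpen Ω) (T : ℝ) (hT : 0 < T)
    (ε μ : R3 → Matrix (Fin 3) (Fin 3) ℝ)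
    (hε : IsMaterialMatrix Ω ε) (hμ : IsMaterialMatrix Ω μ)
    (j₀ : R3 × ℝ → R3) (j₁ : R3 × ℝ → R3 → R3) (hj : IsCurrentDensity Ω T j₀ j₁)
    (e₀ h₀ : L2 Ω) (e h : R3 × ℝ → R3)
    (hsol : IsWeakSolution Ω T ε μ (fun z ξ => j₀ z + j₁ z ξ) e₀ h₀ e h) :
    (∃ ec : ℝ → L2 Ω, IsContinuousRep Ω T e ec) ∧
    (∃ hc : ℝ → L2 Ω, IsContinuousRep Ω T h hc) ∧
    IntegrableOn (fun z => ⟪j₀ z + j₁ z (e z), e z⟫) (spaceTimeCylinder Ω T) ∧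
    ∀ ec hc : ℝ → L2 Ω, IsContinuousRep Ω T e ec → IsContinuousRep Ω T h hc →
      ∀ t ∈ Icc (0 : ℝ) T,
        1 / 2 * (weightedNormSq Ω ε (ec t) + weightedNormSq Ω μ (hc t))
          + (∫ s in (0 : ℝ)..t, ∫ x in Ω,
              ⟪j₀ (x, s) + j₁ (x, s) (e (x, s)), e (x, s)⟫)
        = 1 / 2 * (weightedNormSq Ω ε e₀ + weightedNormSq Ω μ h₀) := by
  have hje := memLp_current hΩ.measurableSet hj hsol.memLp_e
  obtain ⟨E, a, ha, hE, hEs, hEa⟩ := hε.exists_mulOperator hΩ.measurableSet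
  obtain ⟨N, b, hb, hN, hNs, hNb⟩ := hμ.exists_mulOperator hΩ.measurableSet
  obtain ⟨M, m, hm, hM, hMs, hMm⟩ := exists_diagonal_operator ha hb hEs hNs hEa hNb
  obtain ⟨U, hU, hUe⟩ := exists_slice hsol.memLp_e
  obtain ⟨V, hV, hVh⟩ := exists_slice hsol.memLp_h
  obtain ⟨J, hJ, hJj⟩ := exists_slice hje
  obtain ⟨v, hvc, hvu, hven⟩ := (isSkewAdjointGraph_maxwellGraph hΩ).exists_continuous_energy_eq
    hm hMs hMm hT (memLp_toLp_prodMk hU hV)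
    (memLp_toLp_prodMk hJ (MemLp.zero' : MemLp (fun _ : ℝ => (0 : L2 Ω)) 2 _))
    (WithLp.toLp 2 (e₀, h₀)) (by
      rintro _ ⟨Φ, hΦ, Ψ, rfl⟩ ζ hζ hζT
      have := hsol.abstract_weak_form hT hE hN (hU.integrable one_le_two)
        (hV.integrable one_le_two) (hJ.integrable one_le_two) hUe hVh hJj hΦ Ψ hζ hζT
      simp only [hM, WithLp.prod_inner_apply, inner_zero_left, add_zero, inner_neg_right,
        ← sub_eq_add_neg]
      exact this)
  have hec : IsContinuousRep Ω T e (fun t => (v t).fst) := by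
    refine ⟨(WithLp.prod_continuous_ofLp 2 _ _).fst.comp_continuousOn hvc, ?_⟩
    filter_upwards [hvu, hUe] with t h1 h2
    rw [h1]
    exact h2
  have hhc : IsContinuousRep Ω T h (fun t => (v t).snd) := by
    refine ⟨(WithLp.prod_continuous_ofLp 2 _ _).snd.comp_continuousOn hvc, ?_⟩
    filter_upwards [hvu, hVh] with t h1 h2
    rw [h1]
    exact h2
  refine ⟨⟨_, hec⟩, ⟨_, hhc⟩, ?_, fun ec hc he hh t ht => ?_⟩
  · exact (hje.norm.integrable_mul hsol.memLp_e.norm).mono' (hje.1.inner hsol.memLp_e.1)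
      (ae_of_all _ fun z => norm_inner_le_norm _ _)
  have h1 := hven t ht
  simp only [hM, WithLp.prod_inner_apply, inner_zero_left, add_zero] at h1
  rw [he.eqOn hT hec ht, hh.eqOn hT hhc ht]
  simp only [weightedNormSq_eq_inner hE, weightedNormSq_eq_inner hN]
  refine Eq.trans ?_ h1
  refine congrArg₂ (· + ·) rfl ?_
  rw [intervalIntegral.integral_of_le ht.1, intervalIntegral.integral_of_le ht.1,
    integral_Ioc_eq_integral_Ioo, integral_Ioc_eq_integral_Ioo]
  refine integral_congr_ae ?_
  have hmono : volume.restrict (Ioo 0 t) ≤ volume.restrict (Ioo 0 T) :=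
    Measure.restrict_mono (Ioo_subset_Ioo_right ht.2) le_rfl
  filter_upwards [ae_mono hmono hUe, ae_mono hmono hJj] with s h2 h3
  rw [L2.inner_def]
  refine integral_congr_ae ?_
  filter_upwards [h2, h3] with x hx1 hx2
  rw [hx1, hx2]
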